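/- Let $\Omega\subset\mathbb R^2$ be a bounded Borel set and $\Omega_s\subset\Omega$ a Borel set with $|\Omega_s|>0$. For $u\in L^1(\mathbb R^2)$ put $$TV(u)=\sup\Big\{\int_{\mathbb R^2}u\,\operatorname{div}z\;:\;z\in C_c^\infty(\mathbb R^2;\mathbb R^2),\ |z|\le 1\Big\};$$ $u\in BV$ means $TV(u)<\infty$, $\operatorname{Per}E=TV(1_E)$, and $E$ has finite perimeter if $1_E\in BV$. All inclusions between sets are understood up to Lebesgue null sets. Let $\Omega_c$ be a maximal (with respect to inclusion) Cheeger set of $\Omega\setminus\Omega_s$, i.e. a maximal minimizer of $\operatorname{Per}(E)/|E|$ among the sets $E\subset\Omega\setminus\Omega_s$ of finite perimeter with $|E|>0$, and let $\lambda_c=\operatorname{Per}(\Omega_c)/|\Omega_c|$. Let $\Omega_{1c}$ be a minimal (with respect to inclusion) minimizer of $\operatorname{Per}(E)+\lambda_c|E|$ over the sets of finite perimeter with $\Omega_s\subset E\subset\Omega$. (If $\Omega$ is convex, one may equally let $E\supset\Omega_s$ range over all sets of finite perimeter in the plane; for general $\Omega$ one may do so provided that the resulting minimal minimizer $\Omega_{1c}$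 is contained in $\Omega$.) Let $M$ be the class of pairs $(E_1,E_-)$ of Borel subsets of $\Omega$ with $\Omega_s\subset E_1$, $|E_1\cap E_-|=0$ and $|E_-|>0$, and let $$S(E_1,E_-)=\operatorname{Per}E_1+\frac{|E_1|}{|E_-|}\operatorname{Per}E_-.$$ Then: 1. $(\Omega_{1c},\Omega_c)\in M$, and $(\Omega_{1c},\Omega_c)$ minimizes $S$ over $M$. 2. The three-valued function $1_{\Omega_{1c}}-\frac{|\Omega_{1c}|}{|\Omega_c|}1_{\Omega_c}$ minimizes $TV$ among all $v\in BV(\mathbb R^2)$ with $\int_\Omega v=0$, $v=1$ a.e. in $\Omega_s$ and $v=0$ a.e. outside $\Omega$. 3. The critical yield number in its relaxed form, that is, the supremum of $\int_{\Omega_s}v\,/\,TV(v)$ over all $v\in BV(\mathbb R^2)$ with $TV(v)\neq0$, $\int_\Omega v=0$, $v$ a.e. equal to a constant in $\Omega_s$ and $v=0$ a.e. outside $\Omega$, is attained and equals $$\frac{|\Omega_s|}{\operatorname{Per}(\Omega_{1c})+\lambda_c|\Omega_{1c}|}.$$ -/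

import Mathlib

open MeasureTheory Set
open scoped ENNReal

noncomputable section

/-- The Euclidean plane, with Lebesgue measure `volume`. -/
abbrev Plane : Type := EuclideanSpace ℝ (Fin 2)

/-- The divergence `∂₁ z₁ + ∂₂ z₂` of a vector field on the plane. -/
def divergence (z : Plane → Plane) (x : Plane) : ℝ :=
  ∑ i : Fin 2, (fderiv ℝ z x (EuclideanSpace.single i 1)) i

/-- The total variation in the whole plane:
`TV(u) = sup {∫ u div z : z ∈ C_c^∞(ℝ²; ℝ²), |z| ≤ 1}`, meaningful for integrable `u`. -/
def totalVariation (u : Plane → ℝ) : ℝ≥0∞ :=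
  ⨆ (z : Plane → Plane) (_ : ContDiff ℝ ((⊤ : ℕ∞) : WithTop ℕ∞) z) (_ : HasCompactSupport z) (_ : ∀ x, ‖z x‖ ≤ 1),
    ENNReal.ofReal (∫ x, u x * divergence z x)

/-- `u ∈ BV(ℝ²)`. -/
def IsBV (u : Plane → ℝ) : Prop :=
  Integrable u volume ∧ totalVariation u < ⊤

/-- `Per(E) = TV(1_E)`. -/
def perimeter (E : Set Plane) : ℝ≥0∞ :=
  totalVariation (E.indicator fun _ => (1 : ℝ))

/-- `E` is a (Borel) set of finite perimeter in the plane, that is, `1_E ∈ BV(ℝ²)`. -/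
def HasFinitePerimeter (E : Set Plane) : Prop :=
  MeasurableSet E ∧ IsBV (E.indicator fun _ => (1 : ℝ))

/-- The ratio `Per(E) / |E|` minimized in the Cheeger problem. -/
def cheegerRatio (E : Set Plane) : ℝ≥0∞ :=
  perimeter E / volume E

/-- `E` is a Cheeger set of `A`: it minimizes `Per(F) / |F|` over the subsets `F` of `A` of finite
perimeter and positive measure. Sets are taken modulo null sets. -/
def IsCheegerSet (A E : Set Plane) : Prop :=
  HasFinitePerimeter E ∧ volume E ≠ 0 ∧ E ≤ᵐ[volume] A ∧
    ∀ F : Set Plane, HasFinitePerimeter F → volume F ≠ 0 → F ≤ᵐ[volume] A →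
      cheegerRatio E ≤ cheegerRatio F

/-- `E` is a Cheeger set of `A` which is maximal for inclusion (modulo null sets). -/
def IsMaximalCheegerSet (A E : Set Plane) : Prop :=
  IsCheegerSet A E ∧ ∀ F : Set Plane, IsCheegerSet A F → E ≤ᵐ[volume] F → F ≤ᵐ[volume] E

/-- `E` minimizes `Per(F) + lam |F|` over the sets `F` of finite perimeter
with `Ωs ⊂ F ⊂ A` (modulo null sets). -/
def IsObstacleMinimizer (lam : ℝ≥0∞) (Ωs A E : Set Plane) : Prop :=
  HasFinitePerimeter E ∧ Ωs ≤ᵐ[volume] E ∧ E ≤ᵐ[volume] A ∧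
    ∀ F : Set Plane, HasFinitePerimeter F → Ωs ≤ᵐ[volume] F → F ≤ᵐ[volume] A →
      perimeter E + lam * volume E ≤ perimeter F + lam * volume F

/-- `E` is a minimizer in the sense of `IsObstacleMinimizer` which is minimal for inclusion
(modulo null sets). -/
def IsMinimalObstacleMinimizer (lam : ℝ≥0∞) (Ωs A E : Set Plane) : Prop :=
  IsObstacleMinimizer lam Ωs A E ∧
    ∀ F : Set Plane, IsObstacleMinimizer lam Ωs A F → F ≤ᵐ[volume] E → E ≤ᵐ[volume] F

/-- The class `M` of admissible pairs `(E₁, E₋)`: Borel subsets of `Ω` with `Ωs ⊂ E₁`, which do not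
overlap (their intersection is null), and `|E₋| > 0`, so that `S(E₁, E₋)` makes sense. -/
def admissiblePairs (Ω Ωs : Set Plane) : Set (Set Plane × Set Plane) :=
  {p | MeasurableSet p.1 ∧ MeasurableSet p.2 ∧ p.1 ≤ᵐ[volume] Ω ∧ p.2 ≤ᵐ[volume] Ω ∧
    Ωs ≤ᵐ[volume] p.1 ∧ volume (p.1 ∩ p.2) = 0 ∧ volume p.2 ≠ 0}

/-- `S(E₁, E₋) = Per(E₁) + (|E₁| / |E₋|) Per(E₋)`. -/
def pairEnergy (p : Set Plane × Set Plane) : ℝ≥0∞ :=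
  perimeter p.1 + volume p.1 / volume p.2 * perimeter p.2

/-- The three-valued function `1_{E₁} - (|E₁| / |E₋|) 1_{E₋}`. -/
def threeValued (E₁ Em : Set Plane) (x : Plane) : ℝ :=
  E₁.indicator (fun _ => (1 : ℝ)) x -
    volume.real E₁ / volume.real Em * Em.indicator (fun _ => (1 : ℝ)) x

/-- The functions of bounded variation which vanish outside `Ω`, have zero mean (exchange flow
condition) and are equal to the constant `c` in `Ωs`. -/
def exchangeBV (Ω Ωs : Set Plane) (c : ℝ) : Set (Plane → ℝ) :=
  {v | IsBV v ∧ (∫ x in Ω, v x) = 0 ∧ (∀ᵐ x, x ∈ Ωs → v x = c) ∧ ∀ᵐ x, x ∉ Ω → v x = 0}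

/-- The values of the quotient `(∫_{Ωs} v) / TV(v)` over all nonzero exchange flows `v` in `BV`
which are constant in `Ωs`. Its supremum is the critical yield number in relaxed form. -/
def yieldQuotients (Ω Ωs : Set Plane) : Set ℝ :=
  {y | ∃ c : ℝ, ∃ v ∈ exchangeBV Ω Ωs c, totalVariation v ≠ 0 ∧
    y = (∫ x in Ωs, v x) / (totalVariation v).toReal}

end

/-!
The proof rests on one tool, the coarea inequality for the total variation in its dual definition
(`lintegral_perimeter_levelSet_le`): for integrable `v`, the perimeters of `{v > t}`, `t > 0`, and of
`{v ≤ t}`, `t < 0`, integrate to at most `TV(v)`. To see this, let `z₁, …, z_k` be test fields and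
`χ₁, …, χ_k` smooth functions of the value with disjoint supports. If `v` is smooth, `∑ χᵢ(v) zᵢ` is
again a test field, so the total variations of the parts of `v` lying in disjoint slabs of values add
up to at most `TV(v)`; for general `v` mollify. Averaging over the position of slabs of height `h`
and letting `h → 0`, lower semicontinuity of `TV` and Fatou's lemma give the inequality. Only this
inequality is needed, and no structure theory of `BV` functions.

Write `λ` for the Cheeger ratio of `Ωc` and `m = Per(Ω₁c) + λ |Ω₁c|`.

* The coarea inequality for `1_E - 1_F` yields
  `Per(E \ F) + Per(F \ E) ≤ Per(E) + Per(F)`. With `E = Ω₁c` and `F = Ωc` it shows that `Ω₁c \ Ωc`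
  also minimizes `Per + λ |·|`, and minimality of `Ω₁c` forces `|Ω₁c ∩ Ωc| = 0`
  (`IsMinimalObstacleMinimizer.volume_inter_eq_zero`).
* For an exchange flow `v` equal to `1` in `Ωs`, the sets `{v > t}` with `0 < t < 1` compete with
  `Ω₁c`, and the sets `{v ≤ t}` with `t < 0` compete with `Ωc`. Integrating the two minimality
  inequalities over `t`, the area terms cancel because `∫ v = 0`, and `TV(v) ≥ m`
  (`le_totalVariation_of_mem_exchangeBV`). The three-valued function has `TV ≤ m` by
  subadditivity. Homogeneity turns this into the value of the yield number.
* For pairs of sets, the same two minimality inequalities apply directly.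
* If the obstacle problem is posed in the whole plane and `Ω` is convex, `Ω₁c` may be replaced by
  `Ω₁c ∩ Ω`, as cutting with a convex set does not increase the perimeter
  (`perimeter_inter_convex_le`); this is reduced to half-planes, where a test field is continued by
  the constant unit normal.

Finally `m > 0`, which the quotient in the last claim needs, because a bounded set of positive
measure has positive perimeter (`volume_le_mul_perimeter`).
-/

open Filter Topology
open scoped ContDiff Convolution

/-! ### Divergence and test fields -/

/-- The admissible fields in the definition of the total variation. -/
def IsTestField (z : Plane → Plane) : Prop :=
  ContDiff ℝ ∞ z ∧ HasCompactSupport z ∧ ∀ x, ‖z x‖ ≤ 1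

/-- The trace `A ↦ ∑ᵢ (A eᵢ)ᵢ` as a continuous linear form, so that
`divergence z x = traceForm (fderiv ℝ z x)`. -/
noncomputable def traceForm : (Plane →L[ℝ] Plane) →L[ℝ] ℝ :=
  ∑ i : Fin 2, (EuclideanSpace.proj i : Plane →L[ℝ] ℝ).comp
    (ContinuousLinearMap.apply ℝ Plane (EuclideanSpace.single i (1 : ℝ)))

lemma divergence_eq_traceForm (z : Plane → Plane) (x : Plane) :
    divergence z x = traceForm (fderiv ℝ z x) := by
  simp [divergence, traceForm]

lemma traceForm_smulRight (l : Plane →L[ℝ] ℝ) (y : Plane) :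
    traceForm (l.smulRight y) = l y := by
  have hy : y = ∑ i : Fin 2, y i • (EuclideanSpace.single i (1 : ℝ) : Plane) := by
    ext j
    fin_cases j <;> simp
  conv_rhs => rw [hy]
  simp [traceForm, mul_comm]

lemma continuous_divergence {z : Plane → Plane} (hz : ContDiff ℝ ∞ z) :
    Continuous (divergence z) := by
  have : divergence z = fun x => traceForm (fderiv ℝ z x) := funext (divergence_eq_traceForm z)
  rw [this]
  exact traceForm.continuous.comp (hz.continuous_fderiv (by simp))

lemma hasCompactSupport_divergence {z : Plane → Plane} (hz : HasCompactSupport z) :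
    HasCompactSupport (divergence z) := by
  have : divergence z = traceForm ∘ (fderiv ℝ z) := funext (divergence_eq_traceForm z)
  rw [this]
  exact (hz.fderiv ℝ).comp_left (map_zero _)

lemma exists_bound_divergence {z : Plane → Plane} (hz : ContDiff ℝ ∞ z)
    (hc : HasCompactSupport z) : ∃ C, 0 ≤ C ∧ ∀ x, |divergence z x| ≤ C := by
  obtain ⟨C, hC⟩ := (hasCompactSupport_divergence hc).exists_bound_of_continuous
    (continuous_divergence hz)
  exact ⟨C, (norm_nonneg _).trans (hC 0), hC⟩

lemma integrable_divergence {z : Plane → Plane} (hz : ContDiff ℝ ∞ z)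
    (hc : HasCompactSupport z) : Integrable (divergence z) :=
  (continuous_divergence hz).integrable_of_hasCompactSupport (hasCompactSupport_divergence hc)

lemma integrable_mul_divergence {u : Plane → ℝ} (hu : Integrable u) {z : Plane → Plane}
    (hz : ContDiff ℝ ∞ z) (hc : HasCompactSupport z) :
    Integrable (fun x => u x * divergence z x) := by
  obtain ⟨C, -, hC⟩ := exists_bound_divergence hz hc
  exact hu.mul_bdd (continuous_divergence hz).aestronglyMeasurable (ae_of_all _ hC)

lemma divergence_smul {g : Plane → ℝ} {z : Plane → Plane} {x : Plane}
    (hg : DifferentiableAt ℝ g x) (hz : DifferentiableAt ℝ z x) :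
    divergence (fun y => g y • z y) x = g x * divergence z x + fderiv ℝ g x (z x) := by
  rw [divergence_eq_traceForm, divergence_eq_traceForm, fderiv_fun_smul hg hz, map_add, map_smul,
    traceForm_smulRight, smul_eq_mul]

lemma divergence_add {z w : Plane → Plane} {x : Plane}
    (hz : DifferentiableAt ℝ z x) (hw : DifferentiableAt ℝ w x) :
    divergence (fun y => z y + w y) x = divergence z x + divergence w x := by
  simp only [divergence_eq_traceForm, fderiv_fun_add hz hw, map_add]

lemma divergence_sum {ι : Type*} (s : Finset ι) {z : ι → Plane → Plane} {x : Plane}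
    (hz : ∀ i ∈ s, DifferentiableAt ℝ (z i) x) :
    divergence (fun y => ∑ i ∈ s, z i y) x = ∑ i ∈ s, divergence (z i) x := by
  simp only [divergence_eq_traceForm, fderiv_fun_sum hz, map_sum]

lemma integral_divergence_eq_zero {z : Plane → Plane} (hz : ContDiff ℝ ∞ z)
    (hc : HasCompactSupport z) : ∫ x, divergence z x = 0 := by
  have hd : Differentiable ℝ z := hz.differentiable (by simp)
  have hcomp : ∀ i : Fin 2, ∀ x v, (fderiv ℝ z x v) i = fderiv ℝ (fun y => z y i) x v := by
    intro i x v
    have := ((EuclideanSpace.proj i : Plane →L[ℝ] ℝ).hasFDerivAt (x := z x)).comp x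
      (hd x).hasFDerivAt
    have h2 : fderiv ℝ (fun y => z y i) x
      = (EuclideanSpace.proj i : Plane →L[ℝ] ℝ).comp (fderiv ℝ z x) := this.fderiv
    rw [h2]; rfl
  have hsm : ∀ i : Fin 2, ContDiff ℝ ∞ (fun y => z y i) := fun i =>
    (EuclideanSpace.proj i : Plane →L[ℝ] ℝ).contDiff.comp hz
  have hsc : ∀ i : Fin 2, HasCompactSupport (fun y => z y i) := fun i =>
    hc.comp_left (g := fun y : Plane => y i) rfl
  have hint : ∀ i : Fin 2, ∀ v, Integrable (fun x => fderiv ℝ (fun y => z y i) x v) := fun i v =>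
    (((hsm i).continuous_fderiv (by simp)).clm_apply
      continuous_const).integrable_of_hasCompactSupport ((hsc i).fderiv_apply ℝ v)
  have hzero : ∀ i : Fin 2, ∀ v, ∫ x, fderiv ℝ (fun y => z y i) x v = 0 := by
    intro i v
    have := integral_mul_fderiv_eq_neg_fderiv_mul_of_integrable (μ := (volume : Measure Plane))
      (f := fun _ => (1 : ℝ)) (g := fun y => z y i) (v := v) (by simp)
      (by simpa using hint i v)
      (by simpa using (hsm i).continuous.integrable_of_hasCompactSupport (hsc i))
      (fun x _ => by simp) (fun x _ => (hsm i).differentiable (by simp) x)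
    simpa using this
  simp only [divergence, hcomp]
  rw [integral_finsetSum _ fun i _ => hint i _]
  simp [hzero]

/-- Integration by parts against a smooth function. -/
lemma integral_mul_divergence {f : Plane → ℝ} (hf : ContDiff ℝ ∞ f) {z : Plane → Plane}
    (hz : ContDiff ℝ ∞ z) (hc : HasCompactSupport z) :
    ∫ x, f x * divergence z x = -∫ x, fderiv ℝ f x (z x) := by
  have h0 := integral_divergence_eq_zero (hf.smul hz) (hc.smul_left (f := f))
  have h1 : ∀ x, divergence (f • z) x = f x * divergence z x + fderiv ℝ f x (z x) := fun x =>
    divergence_smul (hf.differentiable (by simp) x) (hz.differentiable (by simp) x)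
  simp only [h1] at h0
  rw [integral_add] at h0
  · linarith
  · exact (hf.continuous.mul (continuous_divergence hz)).integrable_of_hasCompactSupport
      (hasCompactSupport_divergence hc).mul_left
  · refine ((hf.continuous_fderiv (by simp)).clm_apply
      hz.continuous).integrable_of_hasCompactSupport (hc.mono ?_)
    intro x hx hzx
    exact hx (by simp [hzx])

/-! ### Elementary properties of the total variation -/

lemma IsTestField.le_totalVariation {z : Plane → Plane} (hz : IsTestField z) (u : Plane → ℝ) :
    ENNReal.ofReal (∫ x, u x * divergence z x) ≤ totalVariation u :=
  le_iSup_of_le z <| le_iSup_of_le hz.1 <| le_iSup_of_le hz.2.1 <| le_iSup_of_le hz.2.2 le_rfl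

lemma totalVariation_le {u : Plane → ℝ} {c : ℝ≥0∞}
    (h : ∀ z, IsTestField z → ENNReal.ofReal (∫ x, u x * divergence z x) ≤ c) :
    totalVariation u ≤ c :=
  iSup_le fun z => iSup_le fun h1 => iSup_le fun h2 => iSup_le fun h3 => h z ⟨h1, h2, h3⟩

lemma totalVariation_eq_iSup (u : Plane → ℝ) :
    totalVariation u =
      ⨆ z : {z // IsTestField z}, ENNReal.ofReal (∫ x, u x * divergence z.1 x) :=
  le_antisymm (totalVariation_le fun z hz => le_iSup_of_le ⟨z, hz⟩ le_rfl)
    (iSup_le fun z => z.2.le_totalVariation u)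

lemma totalVariation_congr {u v : Plane → ℝ} (h : u =ᵐ[volume] v) :
    totalVariation u = totalVariation v := by
  simp only [totalVariation_eq_iSup]
  congr! 3 with z
  exact integral_congr_ae (h.mono fun x hx => by simp [hx])

lemma IsTestField.neg {z : Plane → Plane} (hz : IsTestField z) : IsTestField (-z) :=
  ⟨hz.1.neg, hz.2.1.neg, fun x => by simpa using hz.2.2 x⟩

lemma isTestField_zero : IsTestField 0 :=
  ⟨contDiff_zero_fun, HasCompactSupport.zero, fun x => by simp⟩

lemma divergence_neg (z : Plane → Plane) (x : Plane) :
    divergence (-z) x = -divergence z x := by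
  rw [divergence_eq_traceForm, divergence_eq_traceForm, fderiv_neg, map_neg]

lemma totalVariation_neg (u : Plane → ℝ) : totalVariation (-u) = totalVariation u := by
  have key : ∀ w : Plane → ℝ, totalVariation (-w) ≤ totalVariation w := fun w =>
    totalVariation_le fun z hz => by
      have := hz.neg.le_totalVariation w
      simpa [divergence_neg] using this
  exact le_antisymm (key u) (by simpa using key (-u))

lemma totalVariation_const_mul_of_nonneg {c : ℝ} (hc : 0 ≤ c) (u : Plane → ℝ) :
    totalVariation (fun x => c * u x) = ENNReal.ofReal c * totalVariation u := by
  simp only [totalVariation_eq_iSup, ENNReal.mul_iSup, mul_assoc, integral_const_mul,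
    ENNReal.ofReal_mul hc]

lemma totalVariation_const_mul (c : ℝ) (u : Plane → ℝ) :
    totalVariation (fun x => c * u x) = ENNReal.ofReal |c| * totalVariation u := by
  rcases le_total 0 c with hc | hc
  · rw [abs_of_nonneg hc, totalVariation_const_mul_of_nonneg hc]
  · rw [abs_of_nonpos hc, ← totalVariation_const_mul_of_nonneg (neg_nonneg.2 hc),
      ← totalVariation_neg]
    congr 1
    ext x
    simp

lemma totalVariation_add_le {u v : Plane → ℝ} (hu : Integrable u) (hv : Integrable v) :
    totalVariation (fun x => u x + v x) ≤ totalVariation u + totalVariation v := by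
  refine totalVariation_le fun z hz => ?_
  simp only [add_mul]
  rw [integral_add (integrable_mul_divergence hu hz.1 hz.2.1)
    (integrable_mul_divergence hv hz.1 hz.2.1)]
  exact ENNReal.ofReal_add_le.trans
    (add_le_add (hz.le_totalVariation u) (hz.le_totalVariation v))

/-- Lower semicontinuity of the total variation along dominated sequences. -/
lemma totalVariation_le_liminf {u : ℕ → Plane → ℝ} {v g : Plane → ℝ} (hg : Integrable g)
    (hm : ∀ n, AEStronglyMeasurable (u n) volume) (hb : ∀ᶠ n in atTop, ∀ x, |u n x| ≤ g x)
    (hlim : ∀ᵐ x, Tendsto (fun n => u n x) atTop (𝓝 (v x))) :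
    totalVariation v ≤ liminf (fun n => totalVariation (u n)) atTop := by
  refine totalVariation_le fun z hz => ?_
  obtain ⟨C, hC0, hC⟩ := exists_bound_divergence hz.1 hz.2.1
  have hcont := (continuous_divergence hz.1).aestronglyMeasurable (μ := (volume : Measure Plane))
  have ht : Tendsto (fun n => ∫ x, u n x * divergence z x) atTop
      (𝓝 (∫ x, v x * divergence z x)) := by
    refine tendsto_integral_filter_of_dominated_convergence (fun x => g x * C)
      (Eventually.of_forall fun n => (hm n).mul hcont) ?_ (hg.mul_const C) ?_
    · filter_upwards [hb] with n hn
      refine ae_of_all _ fun x => ?_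
      rw [Real.norm_eq_abs, abs_mul]
      exact mul_le_mul (hn x) (hC x) (abs_nonneg _) ((abs_nonneg _).trans (hn x))
    · filter_upwards [hlim] with x hx using hx.mul_const _
  have ht' := (ENNReal.continuous_ofReal.tendsto _).comp ht
  rw [← ht'.liminf_eq]
  exact liminf_le_liminf (Eventually.of_forall fun n => hz.le_totalVariation (u n))

/-! ### Mollification -/

/-- Moving a mollifier from one factor of an integral to the other. -/
lemma integral_convolution_mul {ρ v φ : Plane → ℝ} (hρ : Integrable ρ)
    (hρs : ∀ x, ρ (-x) = ρ x) (hv : Integrable v) (hφ : Continuous φ)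
    (hφb : ∃ C, ∀ x, ‖φ x‖ ≤ C) :
    ∫ x, (ρ ⋆[ContinuousLinearMap.lsmul ℝ ℝ, volume] v) x * φ x =
      ∫ x, v x * (ρ ⋆[ContinuousLinearMap.lsmul ℝ ℝ, volume] φ) x := by
  obtain ⟨C, hC⟩ := hφb
  have hint : Integrable (fun p : Plane × Plane => v p.2 * ρ (p.1 - p.2) * φ p.1)
      ((volume : Measure Plane).prod volume) := by
    have := hv.convolution_integrand (ContinuousLinearMap.mul ℝ ℝ) hρ
    exact Integrable.mul_bdd this (hφ.comp continuous_fst).aestronglyMeasurable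
      (ae_of_all _ fun p => hC p.1)
  have h1 : ∀ x, (ρ ⋆[ContinuousLinearMap.lsmul ℝ ℝ, volume] v) x * φ x
      = ∫ y, v y * ρ (x - y) * φ x := fun x => by
    rw [convolution_lsmul_swap, ← integral_mul_const]
    simp only [smul_eq_mul, mul_comm (ρ _)]
  have h2 : ∀ y, v y * (ρ ⋆[ContinuousLinearMap.lsmul ℝ ℝ, volume] φ) y
      = ∫ x, v y * ρ (x - y) * φ x := fun y => by
    rw [convolution_lsmul_swap, ← integral_const_mul]
    refine integral_congr_ae (ae_of_all _ fun x => ?_)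
    simp only [smul_eq_mul, mul_assoc, ← hρs (y - x), neg_sub]
  simp only [h1, h2]
  exact integral_integral_swap hint

lemma isTestField_convolution {z : Plane → Plane} (hz : IsTestField z)
    (ρ : ContDiffBump (0 : Plane)) :
    IsTestField (ρ.normed volume ⋆[ContinuousLinearMap.lsmul ℝ ℝ, volume] z) := by
  refine ⟨hz.2.1.contDiff_convolution_right _ ρ.integrable_normed.locallyIntegrable hz.1,
    ρ.hasCompactSupport_normed.convolution _ hz.2.1, fun x => ?_⟩
  rw [convolution_def]
  calc ‖∫ t, ContinuousLinearMap.lsmul ℝ ℝ (ρ.normed volume t) (z (x - t))‖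
      ≤ ∫ t, ρ.normed volume t := by
        refine norm_integral_le_of_norm_le ρ.integrable_normed (ae_of_all _ fun t => ?_)
        rw [ContinuousLinearMap.lsmul_apply, norm_smul, Real.norm_of_nonneg (ρ.nonneg_normed t)]
        exact mul_le_of_le_one_right (ρ.nonneg_normed t) (hz.2.2 _)
    _ = 1 := ρ.integral_normed

lemma divergence_convolution {z : Plane → Plane} (hz : IsTestField z)
    (ρ : ContDiffBump (0 : Plane)) (x : Plane) :
    divergence (ρ.normed volume ⋆[ContinuousLinearMap.lsmul ℝ ℝ, volume] z) x =
      (ρ.normed volume ⋆[ContinuousLinearMap.lsmul ℝ ℝ, volume] divergence z) x := by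
  have h := hz.2.1.hasFDerivAt_convolution_right (ContinuousLinearMap.lsmul ℝ ℝ)
    (ρ.integrable_normed (μ := (volume : Measure Plane))).locallyIntegrable
    (hz.1.of_le (by simp)) x
  have hex := (hz.2.1.fderiv ℝ).convolutionExists_right
    ((ContinuousLinearMap.lsmul ℝ ℝ : ℝ →L[ℝ] Plane →L[ℝ] Plane).precompR Plane)
    (ρ.integrable_normed (μ := (volume : Measure Plane))).locallyIntegrable
    (hz.1.continuous_fderiv (by simp)) x
  rw [divergence_eq_traceForm, h.fderiv, convolution_def, convolution_def,
    ← traceForm.integral_comp_comm hex]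
  refine integral_congr_ae (ae_of_all _ fun t => ?_)
  simp only [divergence_eq_traceForm, ContinuousLinearMap.lsmul_apply]
  rw [← map_smul]
  rfl

/-- Mollification does not increase the total variation. -/
lemma totalVariation_convolution_le {v : Plane → ℝ} (hv : Integrable v)
    (ρ : ContDiffBump (0 : Plane)) :
    totalVariation (ρ.normed volume ⋆[ContinuousLinearMap.lsmul ℝ ℝ, volume] v) ≤
      totalVariation v := by
  refine totalVariation_le fun z hz => ?_
  obtain ⟨C, -, hC⟩ := exists_bound_divergence hz.1 hz.2.1
  rw [integral_convolution_mul ρ.integrable_normed (fun x => ρ.normed_neg x) hv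
    (continuous_divergence hz.1) ⟨C, hC⟩]
  simp only [← divergence_convolution hz ρ]
  exact (isTestField_convolution hz ρ).le_totalVariation v

/-! ### Splitting the total variation over disjoint ranges of values -/

/-- Fields acting on disjoint ranges of values of a smooth function glue to one test field. -/
lemma sum_integral_comp_mul_divergence_le_of_contDiff {ι : Type*} (s : Finset ι)
    {X χ : ι → ℝ → ℝ} (hχ : ∀ i, ContDiff ℝ ∞ (χ i)) (hX : ∀ i r, HasDerivAt (X i) (χ i r) r)
    (h0 : ∀ i r, 0 ≤ χ i r) (h1 : ∀ r, ∑ i ∈ s, χ i r ≤ 1) {z : ι → Plane → Plane}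
    (hz : ∀ i, IsTestField (z i)) {f : Plane → ℝ} (hf : ContDiff ℝ ∞ f) :
    ENNReal.ofReal (∑ i ∈ s, ∫ x, X i (f x) * divergence (z i) x) ≤ totalVariation f := by
  have hXs : ∀ i, ContDiff ℝ ∞ (X i) := fun i => by
    refine contDiff_infty_iff_deriv.2 ⟨fun r => (hX i r).differentiableAt, ?_⟩
    rw [show deriv (X i) = χ i from funext fun r => (hX i r).deriv]
    exact hχ i
  have hws : ∀ i, ContDiff ℝ ∞ (fun x => χ i (f x) • z i x) := fun i =>
    ((hχ i).comp hf).smul (hz i).1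
  have hwc : ∀ i, HasCompactSupport (fun x => χ i (f x) • z i x) := fun i =>
    (hz i).2.1.smul_left (f := fun x => χ i (f x))
  have hw : IsTestField (fun x => ∑ i ∈ s, χ i (f x) • z i x) := by
    refine ⟨ContDiff.sum fun i _ => hws i, ?_, fun x => ?_⟩
    · have : HasCompactSupport (∑ i ∈ s, fun x => χ i (f x) • z i x) := by
        classical
        induction s using Finset.induction_on with
        | empty => simpa using HasCompactSupport.zero
        | insert a t ha ih =>
          rw [Finset.sum_insert ha]
          refine (hwc a).add (ih fun r => le_trans ?_ (h1 r))
          exact Finset.sum_le_sum_of_subset_of_nonneg (Finset.subset_insert a t)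
            fun i _ _ => h0 i r
      convert this using 1
      ext1 x
      simp
    · calc ‖∑ i ∈ s, χ i (f x) • z i x‖ ≤ ∑ i ∈ s, χ i (f x) := by
            refine norm_sum_le_of_le s fun i _ => ?_
            rw [norm_smul, Real.norm_of_nonneg (h0 i _)]
            exact mul_le_of_le_one_right (h0 i _) ((hz i).2.2 x)
        _ ≤ 1 := h1 _
  refine le_trans (le_of_eq ?_) (hw.le_totalVariation f)
  congr 1
  have hterm : ∀ i, ∫ x, X i (f x) * divergence (z i) x =
      ∫ x, f x * divergence (fun x => χ i (f x) • z i x) x := by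
    intro i
    rw [integral_mul_divergence hf (hws i) (hwc i)]
    refine (integral_mul_divergence ((hXs i).comp hf) (hz i).1 (hz i).2.1).trans ?_
    congr 1
    refine integral_congr_ae (ae_of_all _ fun x => ?_)
    have : HasFDerivAt (X i ∘ f) (χ i (f x) • fderiv ℝ f x) x :=
      (hX i (f x)).comp_hasFDerivAt x (hf.differentiable (by simp) x).hasFDerivAt
    simp only [this.fderiv, map_smul, smul_apply]
  simp only [hterm]
  rw [← integral_finsetSum]
  · refine integral_congr_ae (ae_of_all _ fun x => ?_)
    simp only
    rw [divergence_sum s fun i _ => (hws i).differentiable (by simp) x, Finset.mul_sum]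
  · intro i _
    exact (hf.continuous.mul (continuous_divergence (hws i))).integrable_of_hasCompactSupport
      (hasCompactSupport_divergence (hwc i)).mul_left

/-- A sequence of mollifiers concentrating at the origin. -/
noncomputable def mollifier (n : ℕ) : ContDiffBump (0 : Plane) where
  rIn := 1 / (n + 1)
  rOut := 2 / (n + 1)
  rIn_pos := by positivity
  rIn_lt_rOut := by gcongr; norm_num

/-- The gluing inequality passes to integrable functions by mollification: since each `X i` is bounded
and the test fields have compact support, almost everywhere convergence suffices. -/
lemma sum_integral_comp_mul_divergence_le {ι : Type*} (s : Finset ι)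
    {X χ : ι → ℝ → ℝ} (hχ : ∀ i, ContDiff ℝ ∞ (χ i)) (hX : ∀ i r, HasDerivAt (X i) (χ i r) r)
    (h0 : ∀ i r, 0 ≤ χ i r) (h1 : ∀ r, ∑ i ∈ s, χ i r ≤ 1)
    (hB : ∀ i, ∃ B, ∀ r, |X i r| ≤ B) {z : ι → Plane → Plane}
    (hz : ∀ i, IsTestField (z i)) {v : Plane → ℝ} (hv : Integrable v) :
    ENNReal.ofReal (∑ i ∈ s, ∫ x, X i (v x) * divergence (z i) x) ≤ totalVariation v := by
  set f : ℕ → Plane → ℝ := fun n =>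
    (mollifier n).normed volume ⋆[ContinuousLinearMap.lsmul ℝ ℝ, volume] v with hf
  have hfs : ∀ n, ContDiff ℝ ∞ (f n) := fun n =>
    (mollifier n).hasCompactSupport_normed.contDiff_convolution_left _
      (mollifier n).contDiff_normed hv.locallyIntegrable
  have hlim : ∀ᵐ x, Tendsto (fun n => f n x) atTop (𝓝 (v x)) := by
    refine ContDiffBump.ae_convolution_tendsto_right_of_locallyIntegrable (K := 2) ?_
      (Eventually.of_forall fun n => le_of_eq ?_) hv.locallyIntegrable
    · simpa [mollifier] using
        (tendsto_one_div_add_atTop_nhds_zero_nat (𝕜 := ℝ)).const_mul 2 |>.congr fun n => by ring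
    · simp only [mollifier]; ring
  have hXc : ∀ i, Continuous (X i) := fun i =>
    continuous_iff_continuousAt.2 fun r => (hX i r).continuousAt
  have ht : Tendsto (fun n => ∑ i ∈ s, ∫ x, X i (f n x) * divergence (z i) x) atTop
      (𝓝 (∑ i ∈ s, ∫ x, X i (v x) * divergence (z i) x)) := by
    refine tendsto_finsetSum _ fun i _ => ?_
    obtain ⟨B, hB⟩ := hB i
    refine tendsto_integral_of_dominated_convergence (fun x => B * |divergence (z i) x|)
      (fun n => ?_) ((integrable_divergence (hz i).1 (hz i).2.1).abs.const_mul B)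
      (fun n => ae_of_all _ fun x => ?_) ?_
    · exact (((hXc i).comp (hfs n).continuous).mul
        (continuous_divergence (hz i).1)).aestronglyMeasurable
    · rw [Real.norm_eq_abs, abs_mul]
      exact mul_le_mul_of_nonneg_right (hB _) (abs_nonneg _)
    · filter_upwards [hlim] with x hx
      exact (((hXc i).tendsto _).comp hx).mul_const _
  refine le_of_tendsto ((ENNReal.continuous_ofReal.tendsto _).comp ht)
    (Eventually.of_forall fun n => ?_)
  exact (sum_integral_comp_mul_divergence_le_of_contDiff s hχ hX h0 h1 hz (hfs n)).trans
    (totalVariation_convolution_le hv _)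

/-- The part of the value `s` lying between the levels `a ≤ b`: the absolutely continuous
function of `s` that vanishes at `0` and has derivative `1` on `(a, b)` and `0` off `[a, b]`. -/
def levelPiece (a b s : ℝ) : ℝ := max a (min b s) - max a (min b 0)

lemma abs_levelPiece_le (a b s : ℝ) : |levelPiece a b s| ≤ |s| := by
  unfold levelPiece
  grind

lemma continuous_levelPiece (a b : ℝ) : Continuous (levelPiece a b) := by
  unfold levelPiece
  fun_prop

lemma integral_indicator_Ioo {a b : ℝ} (hab : a < b) (s : ℝ) :
    ∫ t in (0 : ℝ)..s, (Ioo a b).indicator (fun _ => (1 : ℝ)) t = levelPiece a b s := by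
  refine MeasureTheory.integral_eq_of_hasDerivAt_off_countable
    (fun s => max a (min b s)) _ (countable_singleton b |>.insert a) (by fun_prop) ?_ ?_
  · rintro x ⟨-, hx⟩
    simp only [mem_insert_iff, mem_singleton_iff, not_or] at hx
    rcases lt_or_gt_of_ne hx.1 with h | h
    · rw [indicator_of_notMem (by simp [h.le])]
      refine (hasDerivAt_const x a).congr_of_eventuallyEq ?_
      filter_upwards [gt_mem_nhds h] with y hy
      grind
    · rcases lt_or_gt_of_ne hx.2 with h' | h'
      · rw [indicator_of_mem (by exact ⟨h, h'⟩)]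
        refine (hasDerivAt_id x).congr_of_eventuallyEq ?_
        filter_upwards [lt_mem_nhds h, gt_mem_nhds h'] with y hy hy'
        simp only [id]
        grind
      · rw [indicator_of_notMem (by simp [h'.le])]
        refine (hasDerivAt_const x b).congr_of_eventuallyEq ?_
        filter_upwards [lt_mem_nhds h'] with y hy
        grind
  · refine Integrable.intervalIntegrable ?_
    exact (integrable_indicator_iff measurableSet_Ioo).2 (by simp)

/-- Smooth functions with values in `[0, 1]`, supported in `[a, b]` and converging pointwise to the
indicator of `(a, b)`. -/
noncomputable def smoothBump (a b : ℝ) (n : ℕ) (r : ℝ) : ℝ :=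
  Real.smoothTransition (n * (r - a)) * Real.smoothTransition (n * (b - r))

lemma contDiff_smoothBump (a b : ℝ) (n : ℕ) : ContDiff ℝ ∞ (smoothBump a b n) := by
  unfold smoothBump
  exact (Real.smoothTransition.contDiff.comp (by fun_prop)).mul
    (Real.smoothTransition.contDiff.comp (by fun_prop))

lemma smoothBump_nonneg (a b : ℝ) (n : ℕ) (r : ℝ) : 0 ≤ smoothBump a b n r :=
  mul_nonneg (Real.smoothTransition.nonneg _) (Real.smoothTransition.nonneg _)

lemma smoothBump_le_one (a b : ℝ) (n : ℕ) (r : ℝ) : smoothBump a b n r ≤ 1 :=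
  mul_le_one₀ (Real.smoothTransition.le_one _) (Real.smoothTransition.nonneg _)
    (Real.smoothTransition.le_one _)

lemma smoothBump_of_notMem {a b : ℝ} (n : ℕ) {r : ℝ} (hr : r ∉ Ioo a b) :
    smoothBump a b n r = 0 := by
  unfold smoothBump
  rw [mem_Ioo, not_and_or, not_lt, not_lt] at hr
  rcases hr with h | h
  · rw [Real.smoothTransition.zero_of_nonpos, zero_mul]
    exact mul_nonpos_of_nonneg_of_nonpos n.cast_nonneg (sub_nonpos.2 h)
  · rw [Real.smoothTransition.zero_of_nonpos (x := _ * (b - r)), mul_zero]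
    exact mul_nonpos_of_nonneg_of_nonpos n.cast_nonneg (sub_nonpos.2 h)

lemma tendsto_smoothBump (a b r : ℝ) : Tendsto (fun n => smoothBump a b n r) atTop
    (𝓝 ((Ioo a b).indicator (fun _ => (1 : ℝ)) r)) := by
  by_cases hr : r ∈ Ioo a b
  · rw [indicator_of_mem hr]
    have h : ∀ c : ℝ, 0 < c → ∀ᶠ n : ℕ in atTop, 1 ≤ (n : ℝ) * c := fun c hc =>
      (tendsto_natCast_atTop_atTop.atTop_mul_const hc).eventually_ge_atTop 1
    refine tendsto_const_nhds.congr' ?_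
    filter_upwards [h _ (sub_pos.2 hr.1), h _ (sub_pos.2 hr.2)] with n h1 h2
    simp [smoothBump, Real.smoothTransition.one_of_one_le h1,
      Real.smoothTransition.one_of_one_le h2]
  · rw [indicator_of_notMem hr]
    exact tendsto_const_nhds.congr fun n => (smoothBump_of_notMem n hr).symm

/-- The smooth approximation of `levelPiece a b`. -/
noncomputable def smoothPiece (a b : ℝ) (n : ℕ) (s : ℝ) : ℝ :=
  ∫ t in (0 : ℝ)..s, smoothBump a b n t

lemma hasDerivAt_smoothPiece (a b : ℝ) (n : ℕ) (s : ℝ) :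
    HasDerivAt (smoothPiece a b n) (smoothBump a b n s) s :=
  (contDiff_smoothBump a b n).continuous.integral_hasStrictDerivAt 0 s |>.hasDerivAt

lemma abs_smoothPiece_le (a b : ℝ) (n : ℕ) (s : ℝ) : |smoothPiece a b n s| ≤ |s| := by
  unfold smoothPiece
  have := intervalIntegral.norm_integral_le_of_norm_le_const (a := 0) (b := s) (C := 1)
    (f := smoothBump a b n) fun x _ => by
      rw [Real.norm_of_nonneg (smoothBump_nonneg a b n x)]
      exact smoothBump_le_one a b n x
  simpa using this

lemma exists_bound_smoothPiece (a b : ℝ) (n : ℕ) : ∃ B, ∀ s, |smoothPiece a b n s| ≤ B := by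
  have hint : Integrable (smoothBump a b n) := by
    refine (contDiff_smoothBump a b n).continuous.integrable_of_hasCompactSupport ?_
    exact HasCompactSupport.intro (isCompact_Icc (a := a) (b := b)) fun x hx =>
      smoothBump_of_notMem n fun h => hx (Ioo_subset_Icc_self h)
  refine ⟨∫ t, ‖smoothBump a b n t‖, fun s => ?_⟩
  refine (intervalIntegral.norm_integral_le_integral_norm_uIoc (f := smoothBump a b n)).trans ?_
  exact setIntegral_le_integral hint.norm (ae_of_all _ fun x => norm_nonneg _)

lemma tendsto_smoothPiece {a b : ℝ} (hab : a < b) (s : ℝ) :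
    Tendsto (fun n => smoothPiece a b n s) atTop (𝓝 (levelPiece a b s)) := by
  rw [← integral_indicator_Ioo hab]
  refine intervalIntegral.tendsto_integral_filter_of_dominated_convergence (fun _ => 1)
    (Eventually.of_forall fun n =>
      (contDiff_smoothBump a b n).continuous.aestronglyMeasurable)
    (Eventually.of_forall fun n => ae_of_all _ fun x _ => ?_)
    intervalIntegrable_const (ae_of_all _ fun x _ => tendsto_smoothBump a b x)
  rw [Real.norm_of_nonneg (smoothBump_nonneg a b n x)]
  exact smoothBump_le_one a b n x

lemma sum_integral_levelPiece_mul_divergence_le {ι : Type*} (s : Finset ι) {a b : ι → ℝ}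
    (hab : ∀ i, a i < b i) (hd : Pairwise fun i j => Disjoint (Ioo (a i) (b i)) (Ioo (a j) (b j)))
    {z : ι → Plane → Plane} (hz : ∀ i, IsTestField (z i)) {v : Plane → ℝ} (hv : Integrable v) :
    ENNReal.ofReal (∑ i ∈ s, ∫ x, levelPiece (a i) (b i) (v x) * divergence (z i) x) ≤
      totalVariation v := by
  have ht : Tendsto (fun n => ∑ i ∈ s, ∫ x, smoothPiece (a i) (b i) n (v x) * divergence (z i) x)
      atTop (𝓝 (∑ i ∈ s, ∫ x, levelPiece (a i) (b i) (v x) * divergence (z i) x)) := by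
    refine tendsto_finsetSum _ fun i _ => ?_
    obtain ⟨C, -, hC⟩ := exists_bound_divergence (hz i).1 (hz i).2.1
    refine tendsto_integral_of_dominated_convergence (fun x => |v x| * C)
      (fun n => ?_) (hv.abs.mul_const C) (fun n => ae_of_all _ fun x => ?_)
      (ae_of_all _ fun x => (tendsto_smoothPiece (hab i) (v x)).mul_const _)
    · refine AEStronglyMeasurable.mul ?_ (continuous_divergence (hz i).1).aestronglyMeasurable
      exact (continuous_iff_continuousAt.2 fun r =>
        (hasDerivAt_smoothPiece _ _ n r).continuousAt).comp_aestronglyMeasurable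
          hv.aestronglyMeasurable
    · rw [Real.norm_eq_abs, abs_mul]
      exact mul_le_mul (abs_smoothPiece_le _ _ _ _) (hC x) (abs_nonneg _) (abs_nonneg _)
  refine le_of_tendsto ((ENNReal.continuous_ofReal.tendsto _).comp ht)
    (Eventually.of_forall fun n => ?_)
  refine sum_integral_comp_mul_divergence_le s (fun i => contDiff_smoothBump (a i) (b i) n)
    (fun i => hasDerivAt_smoothPiece (a i) (b i) n) (fun i => smoothBump_nonneg (a i) (b i) n)
    (fun r => ?_) (fun i => exists_bound_smoothPiece (a i) (b i) n) hz hv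
  by_cases h : ∃ j ∈ s, r ∈ Ioo (a j) (b j)
  · obtain ⟨j, hj, hr⟩ := h
    rw [Finset.sum_eq_single_of_mem j hj]
    · exact smoothBump_le_one _ _ _ _
    · intro i _ hij
      exact smoothBump_of_notMem n fun hri => (hd hij).le_bot ⟨hri, hr⟩
  · push Not at h
    rw [Finset.sum_eq_zero fun i hi => smoothBump_of_notMem n (h i hi)]
    exact zero_le_one

lemma sum_iSup_le {ι Z : Type*} [Nonempty Z] (s : Finset ι) {f : ι → Z → ℝ≥0∞}
    {c : ℝ≥0∞} (h : ∀ z : ι → Z, ∑ i ∈ s, f i (z i) ≤ c) : ∑ i ∈ s, ⨆ z, f i z ≤ c := by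
  classical
  have h1 : ∀ i, ⨆ z, f i z = ⨆ z : ι → Z, f i (z i) := fun i =>
    ((Function.surjective_eval (β := fun _ : ι => Z) i).iSup_comp (f i)).symm
  simp only [h1]
  rw [ENNReal.finsetSum_iSup]
  · exact iSup_le h
  · intro y z
    refine ⟨fun i => if f i (y i) ≤ f i (z i) then z i else y i, fun i => ?_⟩
    by_cases hi : f i (y i) ≤ f i (z i)
    · simp [hi]
    · simp [hi, (not_le.1 hi).le]

/-- The total variations of the parts of `v` lying in disjoint ranges of values add up to at most
the total variation of `v`. -/
lemma sum_totalVariation_levelPiece_le {ι : Type*} (s : Finset ι) {a b : ι → ℝ}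
    (hab : ∀ i, a i < b i) (hd : Pairwise fun i j => Disjoint (Ioo (a i) (b i)) (Ioo (a j) (b j)))
    {v : Plane → ℝ} (hv : Integrable v) :
    ∑ i ∈ s, totalVariation (fun x => levelPiece (a i) (b i) (v x)) ≤ totalVariation v := by
  have : Nonempty {z // IsTestField z} := ⟨⟨0, isTestField_zero⟩⟩
  simp only [totalVariation_eq_iSup (fun x => levelPiece _ _ (v x))]
  -- indices whose integral is negative contribute nothing and are dropped before gluing the fields
  refine sum_iSup_le s fun z => ?_
  set I : ι → ℝ := fun i => ∫ x, levelPiece (a i) (b i) (v x) * divergence (z i).1 x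
  calc ∑ i ∈ s, ENNReal.ofReal (I i)
      = ∑ i ∈ s with 0 ≤ I i, ENNReal.ofReal (I i) := by
        rw [Finset.sum_filter]
        refine Finset.sum_congr rfl fun i _ => ?_
        split_ifs with h
        · rfl
        · exact ENNReal.ofReal_of_nonpos (not_le.1 h).le
    _ = ENNReal.ofReal (∑ i ∈ s with 0 ≤ I i, I i) :=
        (ENNReal.ofReal_sum_of_nonneg fun i hi => (Finset.mem_filter.1 hi).2).symm
    _ ≤ totalVariation v :=
        sum_integral_levelPiece_mul_divergence_le _ hab hd (fun i => (z i).2) hv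

/-! ### The coarea inequality -/

/-- The layer of the value `s` at level `t`: it is `1_{t < s}` for `t ≥ 0` and `-1_{s ≤ t}` for
`t < 0`, so that integrating over all levels `t` gives back `s`. -/
noncomputable def signedLayer (t s : ℝ) : ℝ :=
  (if t < s then 1 else 0) - (if t < 0 then 1 else 0)

lemma tendsto_levelPiece_signedLayer (t s : ℝ) :
    Tendsto (fun n : ℕ => ((n : ℝ) + 1) * levelPiece t (t + 1 / ((n : ℝ) + 1)) s) atTop
      (𝓝 (signedLayer t s)) := by
  have hsmall : ∀ c : ℝ, 0 < c → ∀ᶠ n : ℕ in atTop, 1 / ((n : ℝ) + 1) < c := fun c hc =>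
    (tendsto_one_div_add_atTop_nhds_zero_nat (𝕜 := ℝ)).eventually (gt_mem_nhds hc)
  have h1 : ∀ᶠ n : ℕ in atTop, t < s → 1 / ((n : ℝ) + 1) < s - t := by
    by_cases h : t < s
    · filter_upwards [hsmall _ (sub_pos.2 h)] with n hn _ using hn
    · exact Eventually.of_forall fun n hn => absurd hn h
  have h2 : ∀ᶠ n : ℕ in atTop, t < 0 → 1 / ((n : ℝ) + 1) < -t := by
    by_cases h : t < 0
    · filter_upwards [hsmall _ (neg_pos.2 h)] with n hn _ using hn
    · exact Eventually.of_forall fun n hn => absurd hn h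
  refine tendsto_const_nhds.congr' ?_
  filter_upwards [h1, h2] with n hn1 hn2
  have hpos : (0 : ℝ) < (n : ℝ) + 1 := by positivity
  have hmul : ((n : ℝ) + 1) * (1 / ((n : ℝ) + 1)) = 1 := by field_simp
  have hh : (0 : ℝ) < 1 / ((n : ℝ) + 1) := by positivity
  generalize (1 : ℝ) / ((n : ℝ) + 1) = h at *
  have key : levelPiece t (t + h) s = h * signedLayer t s := by
    unfold levelPiece signedLayer
    split_ifs with h3 h4 h4 <;> grind
  rw [key, ← mul_assoc, hmul, one_mul]

lemma abs_levelPiece_le_of_le {t h : ℝ} (ht : t ≠ 0) (hh : 0 < h) (hht : h ≤ |t| / 2) (s : ℝ) :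
    |levelPiece t (t + h) s| ≤ h * (2 * |s| / |t|) := by
  have ht' : 0 < |t| := abs_pos.2 ht
  by_cases hs : |t| / 2 ≤ |s|
  · have h1 : 1 ≤ 2 * |s| / |t| := by
      rw [le_div_iff₀ ht']; linarith
    have h2 : |levelPiece t (t + h) s| ≤ h := by
      unfold levelPiece
      grind
    exact h2.trans (le_mul_of_one_le_right hh.le h1)
  · have h0 : levelPiece t (t + h) s = 0 := by
      unfold levelPiece
      grind
    rw [h0, abs_zero]
    positivity

/-- The map is a supremum of continuous functions of `t`, hence lower semicontinuous. -/
lemma measurable_totalVariation_levelPiece {v : Plane → ℝ} (hv : Integrable v) (h : ℝ) :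
    Measurable fun t => totalVariation (fun x => levelPiece t (t + h) (v x)) := by
  simp only [totalVariation_eq_iSup]
  refine (lowerSemicontinuous_iSup fun z : {z // IsTestField z} =>
    Continuous.lowerSemicontinuous ?_).measurable
  refine ENNReal.continuous_ofReal.comp ?_
  obtain ⟨C, -, hC⟩ := exists_bound_divergence z.2.1 z.2.2.1
  refine continuous_of_dominated (bound := fun x => |v x| * C) (fun t => ?_)
    (fun t => ae_of_all _ fun x => ?_) (hv.abs.mul_const C) (ae_of_all _ fun x => ?_)
  · exact ((continuous_levelPiece _ _).comp_aestronglyMeasurable hv.aestronglyMeasurable).mul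
      (continuous_divergence z.2.1).aestronglyMeasurable
  · rw [Real.norm_eq_abs, abs_mul]
    exact mul_le_mul (abs_levelPiece_le _ _ _) (hC x) (abs_nonneg _) (abs_nonneg _)
  · unfold levelPiece
    fun_prop

/-- Averaging the splitting of the total variation into slabs of height `h` over all shifts of the
slabs. -/
lemma lintegral_totalVariation_levelPiece_le {v : Plane → ℝ} (hv : Integrable v) {h : ℝ}
    (hh : 0 < h) :
    ∫⁻ t, totalVariation (fun x => levelPiece t (t + h) (v x)) ≤
      ENNReal.ofReal h * totalVariation v := by
  set G : ℝ → ℝ≥0∞ := fun t => totalVariation (fun x => levelPiece t (t + h) (v x)) with hG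
  have hmeas : Measurable G := measurable_totalVariation_levelPiece hv h
  have hle : ∀ t : ℝ, ∑' k : AddSubgroup.zmultiples h,
      G ((k : ℝ) + t) ≤ totalVariation v := by
    intro t
    rw [ENNReal.tsum_eq_iSup_sum]
    refine iSup_le fun s => sum_totalVariation_levelPiece_le s (fun k => by linarith) ?_ hv
    rintro ⟨_, m, rfl⟩ ⟨_, n, rfl⟩ hmn
    have hmn' : m ≠ n := by rintro rfl; exact hmn rfl
    have key : ∀ p q : ℤ, p < q → ((p • h : ℝ) + t) + h ≤ (q • h : ℝ) + t := by
      intro p q hpq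
      have : ((p : ℝ) + 1) * h ≤ q * h :=
        mul_le_mul_of_nonneg_right (by exact_mod_cast hpq) hh.le
      simp only [zsmul_eq_mul]
      linarith
    rw [Set.disjoint_left]
    rintro r ⟨h1, h2⟩ ⟨h3, h4⟩
    change (m • h : ℝ) + t < r at h1
    change r < (m • h : ℝ) + t + h at h2
    change (n • h : ℝ) + t < r at h3
    change r < (n • h : ℝ) + t + h at h4
    rcases lt_or_gt_of_ne hmn' with hlt | hlt
    · have := key _ _ hlt; linarith
    · have := key _ _ hlt; linarith
  calc ∫⁻ t, G t
      = ∑' k : AddSubgroup.zmultiples h, ∫⁻ t in Ioc 0 (0 + h), G ((k : ℝ) + t) :=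
        (isAddFundamentalDomain_Ioc hh 0 (volume : Measure ℝ)).lintegral_eq_tsum'' G
    _ = ∫⁻ t in Ioc 0 (0 + h), ∑' k : AddSubgroup.zmultiples h, G ((k : ℝ) + t) :=
        (lintegral_tsum fun k : AddSubgroup.zmultiples h =>
          (hmeas.comp (measurable_const_add (k : ℝ))).aemeasurable).symm
    _ ≤ ∫⁻ _ in Ioc 0 (0 + h), totalVariation v := lintegral_mono fun t => hle t
    _ = ENNReal.ofReal h * totalVariation v := by
      rw [setLIntegral_const, Real.volume_Ioc, mul_comm]; simp

/-- The coarea inequality in terms of layers. The integrand on the left is not claimed to be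
measurable: Fatou's lemma bounds it by a measurable function. -/
lemma lintegral_totalVariation_signedLayer_le {v : Plane → ℝ} (hv : Integrable v) :
    ∫⁻ t, totalVariation (fun x => signedLayer t (v x)) ≤ totalVariation v := by
  set g : ℕ → ℝ → ℝ≥0∞ := fun n t => totalVariation (fun x =>
    ((n : ℝ) + 1) * levelPiece t (t + 1 / ((n : ℝ) + 1)) (v x)) with hg
  have hpos : ∀ n : ℕ, (0 : ℝ) < (n : ℝ) + 1 := fun n => by positivity
  have hgeq : ∀ n t, g n t = ENNReal.ofReal ((n : ℝ) + 1) *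
      totalVariation (fun x => levelPiece t (t + 1 / ((n : ℝ) + 1)) (v x)) := fun n t =>
    totalVariation_const_mul_of_nonneg (hpos n).le _
  have hgm : ∀ n, Measurable (g n) := fun n => by
    simp only [funext (hgeq n)]
    exact (measurable_totalVariation_levelPiece hv _).const_mul _
  have hgle : ∀ n, ∫⁻ t, g n t ≤ totalVariation v := fun n => by
    simp only [hgeq n]
    rw [lintegral_const_mul _ (measurable_totalVariation_levelPiece hv _)]
    refine (mul_le_mul_right (lintegral_totalVariation_levelPiece_le hv
      (one_div_pos.2 (hpos n))) _).trans ?_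
    rw [← mul_assoc, ← ENNReal.ofReal_mul (hpos n).le, mul_one_div_cancel (hpos n).ne']
    simp
  calc ∫⁻ t, totalVariation (fun x => signedLayer t (v x))
      ≤ ∫⁻ t, liminf (fun n => g n t) atTop := by
        refine lintegral_mono_ae ?_
        filter_upwards [compl_mem_ae_iff.2 (measure_singleton (0 : ℝ))] with t ht
        refine totalVariation_le_liminf (g := fun x => 2 * |v x| / |t|)
          ((hv.abs.const_mul 2).div_const _) (fun n => ?_) ?_
          (ae_of_all _ fun x => tendsto_levelPiece_signedLayer t (v x))
        · exact ((continuous_levelPiece _ _).comp_aestronglyMeasurable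
            hv.aestronglyMeasurable).const_mul _
        · filter_upwards [(tendsto_one_div_add_atTop_nhds_zero_nat (𝕜 := ℝ)).eventually
            (ge_mem_nhds (half_pos (abs_pos.2 ht)))] with n hn x
          rw [abs_mul, abs_of_pos (hpos n)]
          refine (mul_le_mul_of_nonneg_left (abs_levelPiece_le_of_le ht
            (one_div_pos.2 (hpos n)) hn (v x)) (hpos n).le).trans_eq ?_
          rw [← mul_assoc, mul_one_div_cancel (hpos n).ne', one_mul]
    _ ≤ liminf (fun n => ∫⁻ t, g n t) atTop := lintegral_liminf_le hgm
    _ ≤ totalVariation v :=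
        liminf_le_of_le (by isBoundedDefault) fun b hb =>
          let ⟨n, hn⟩ := hb.exists; hn.trans (hgle n)

/-- The coarea inequality: the perimeters of the superlevel sets at positive levels and of the
sublevel sets at negative levels integrate to at most the total variation. -/
lemma lintegral_perimeter_levelSet_le {v : Plane → ℝ} (hv : Integrable v) :
    (∫⁻ t in Iio 0, perimeter {x | v x ≤ t}) + (∫⁻ t in Ioi 0, perimeter {x | t < v x}) ≤
      totalVariation v := by
  refine le_trans ?_ (lintegral_totalVariation_signedLayer_le hv)
  have h1 : ∀ t ∈ Iio (0 : ℝ), perimeter {x | v x ≤ t} =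
      totalVariation (fun x => signedLayer t (v x)) := fun t ht => by
    rw [perimeter, ← totalVariation_neg]
    congr 1
    ext x
    by_cases hx : v x ≤ t
    · simp [signedLayer, hx, not_lt.2 hx, show t < 0 from ht]
    · simp [signedLayer, hx, not_le.1 hx, show t < 0 from ht]
  have h2 : ∀ t ∈ Ioi (0 : ℝ), perimeter {x | t < v x} =
      totalVariation (fun x => signedLayer t (v x)) := fun t ht => by
    have ht : ¬ t < 0 := not_lt.2 (le_of_lt ht)
    rw [perimeter]
    congr 1
    ext x
    by_cases hx : t < v x
    · simp [signedLayer, hx, ht]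
    · simp [signedLayer, hx, ht]
  rw [setLIntegral_congr_fun measurableSet_Iio h1, setLIntegral_congr_fun measurableSet_Ioi h2,
    ← lintegral_union measurableSet_Ioi (by
      rw [Set.disjoint_left]; exact fun x hx hx' => lt_asymm (mem_Iio.1 hx) (mem_Ioi.1 hx'))]
  exact setLIntegral_le_lintegral _ _

/-- Exchanging two sets `E`, `F` for their differences does not increase the total perimeter: this
is the coarea inequality for `1_E - 1_F`. -/
lemma perimeter_diff_add_perimeter_diff_le {E F : Set Plane}
    (hE : Integrable (E.indicator fun _ => (1 : ℝ))) (hF : Integrable (F.indicator fun _ => (1 : ℝ))) :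
    perimeter (E \ F) + perimeter (F \ E) ≤ perimeter E + perimeter F := by
  set u : Plane → ℝ := fun x =>
    E.indicator (fun _ => (1 : ℝ)) x + (-F.indicator (fun _ => (1 : ℝ))) x with hu
  have hui : Integrable u := hE.add hF.neg
  have h1 : ∀ t ∈ Ioo (0 : ℝ) 1, perimeter {x | t < u x} = perimeter (E \ F) := fun t ht => by
    congr 1
    ext x
    have := ht.1; have := ht.2
    by_cases hxE : x ∈ E <;> by_cases hxF : x ∈ F <;> simp [hu, hxE, hxF] <;> linarith
  have h2 : ∀ t ∈ Ioo (-1 : ℝ) 0, perimeter {x | u x ≤ t} = perimeter (F \ E) := fun t ht => by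
    congr 1
    ext x
    have := ht.1; have := ht.2
    by_cases hxE : x ∈ E <;> by_cases hxF : x ∈ F <;> simp [hu, hxE, hxF] <;> linarith
  calc perimeter (E \ F) + perimeter (F \ E)
      = (∫⁻ t in Ioo (-1) 0, perimeter {x | u x ≤ t}) +
          ∫⁻ t in Ioo 0 1, perimeter {x | t < u x} := by
        rw [setLIntegral_congr_fun measurableSet_Ioo h1, setLIntegral_congr_fun measurableSet_Ioo h2]
        simp [add_comm]
    _ ≤ (∫⁻ t in Iio 0, perimeter {x | u x ≤ t}) + ∫⁻ t in Ioi 0, perimeter {x | t < u x} :=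
        add_le_add (lintegral_mono_set Ioo_subset_Iio_self)
          (lintegral_mono_set Ioo_subset_Ioi_self)
    _ ≤ totalVariation u := lintegral_perimeter_levelSet_le hui
    _ ≤ perimeter E + perimeter F := by
        refine (totalVariation_add_le hE hF.neg).trans_eq ?_
        rw [totalVariation_neg]
        rfl

/-! ### Restriction to convex sets -/

/-- Cut-off functions at infinity with gradients tending to zero uniformly. -/
lemma exists_cutoff : ∃ (η : ℕ → Plane → ℝ) (C : ℝ), (∀ n, ContDiff ℝ ∞ (η n)) ∧
    (∀ n, HasCompactSupport (η n)) ∧ (∀ n x, 0 ≤ η n x) ∧ (∀ n x, η n x ≤ 1) ∧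
    (∀ x, Tendsto (fun n => η n x) atTop (𝓝 1)) ∧
    ∀ n x y, ‖y‖ ≤ 1 → |fderiv ℝ (η n) x y| ≤ C / ((n : ℝ) + 1) := by
  let φ : ContDiffBump (0 : Plane) := ⟨1, 2, one_pos, one_lt_two⟩
  have hφs : ContDiff ℝ ∞ φ := φ.contDiff
  obtain ⟨C, hC⟩ := (φ.hasCompactSupport.fderiv ℝ).exists_bound_of_continuous
    (hφs.continuous_fderiv (by simp))
  have hpos : ∀ n : ℕ, (0 : ℝ) < (n : ℝ) + 1 := fun n => by positivity
  refine ⟨fun n x => φ (((n : ℝ) + 1)⁻¹ • x), C, fun n => hφs.comp (by fun_prop), fun n => ?_,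
    fun n x => φ.nonneg, fun n x => φ.le_one, fun x => ?_, fun n x y hy => ?_⟩
  · exact φ.hasCompactSupport.comp_smul (inv_pos.2 (hpos n)).ne'
  · have : Tendsto (fun n : ℕ => φ (((n : ℝ) + 1)⁻¹ • x)) atTop (𝓝 (φ ((0 : ℝ) • x))) := by
      refine (φ.continuous.tendsto _).comp (Tendsto.smul_const ?_ x)
      simpa using tendsto_one_div_add_atTop_nhds_zero_nat (𝕜 := ℝ)
    rwa [zero_smul, φ.one_of_mem_closedBall (Metric.mem_closedBall_self φ.rIn_pos.le)] at this
  · have h1 : HasFDerivAt (fun x : Plane => ((n : ℝ) + 1)⁻¹ • x)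
        (((n : ℝ) + 1)⁻¹ • ContinuousLinearMap.id ℝ Plane) x :=
      (hasFDerivAt_id x).fun_const_smul _
    have h2 := ((hφs.differentiable (by simp) (((n : ℝ) + 1)⁻¹ • x)).hasFDerivAt.comp x h1).fderiv
    change |fderiv ℝ (φ ∘ fun x : Plane => ((n : ℝ) + 1)⁻¹ • x) x y| ≤ _
    rw [h2]
    simp only [ContinuousLinearMap.comp_apply, smul_apply,
      ContinuousLinearMap.id_apply, map_smul, smul_eq_mul, abs_mul, abs_inv, abs_of_pos (hpos n)]
    rw [div_eq_inv_mul]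
    refine mul_le_mul_of_nonneg_left ?_ (inv_pos.2 (hpos n)).le
    refine ((fderiv ℝ φ _).le_opNorm y).trans ?_
    exact (mul_le_of_le_one_right (norm_nonneg _) hy).trans (hC _)

/-- Cutting a nonnegative function along a line does not increase its total variation: a field on
the half-plane is continued by the unit normal beyond the line, and the transition only adds to the
divergence. -/
lemma totalVariation_indicator_halfSpace_le (l : Plane →L[ℝ] ℝ) (c : ℝ) {u : Plane → ℝ}
    (hu : Integrable u) (hu0 : ∀ x, 0 ≤ u x) :
    totalVariation ({x | l x ≤ c}.indicator u) ≤ totalVariation u := by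
  refine totalVariation_le fun z hz => ?_
  obtain ⟨η, C, hηs, hηc, hη0, hη1, hηlim, hηd⟩ := exists_cutoff
  obtain ⟨K, hK0, hK⟩ := exists_bound_divergence hz.1 hz.2.1
  have hC0 : 0 ≤ C := by simpa using (abs_nonneg _).trans (hηd 0 0 0 (by simp))
  set ν : Plane := ‖l‖⁻¹ • (InnerProductSpace.toDual ℝ Plane).symm l with hν
  have hνn : ‖ν‖ ≤ 1 := by
    rw [hν, norm_smul, LinearIsometryEquiv.norm_map, norm_inv, norm_norm]
    exact inv_mul_le_one
  have hlν : l ν = ‖l‖ := by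
    rw [hν, map_smul, ← InnerProductSpace.toDual_symm_apply, real_inner_self_eq_norm_sq,
      LinearIsometryEquiv.norm_map, smul_eq_mul]
    rcases eq_or_ne ‖l‖ 0 with h | h
    · simp [h]
    · field_simp
  have hlz : ∀ x, 0 ≤ l (ν - z x) := fun x => by
    rw [map_sub, hlν, sub_nonneg]
    refine (le_abs_self _).trans ((l.le_opNorm _).trans ?_)
    exact mul_le_of_le_one_right (norm_nonneg _) (hz.2.2 x)
  set σ : ℕ → Plane → ℝ := fun n x => Real.smoothTransition (n * (l x - c)) with hσ
  have hσs : ∀ n, ContDiff ℝ ∞ (σ n) := fun n =>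
    Real.smoothTransition.contDiff.comp (by fun_prop)
  have hσ0 : ∀ n x, 0 ≤ σ n x := fun n x => Real.smoothTransition.nonneg _
  have hσ1 : ∀ n x, σ n x ≤ 1 := fun n x => Real.smoothTransition.le_one _
  have hσd : ∀ n x y, 0 ≤ l y → 0 ≤ fderiv ℝ (σ n) x y := by
    intro n x y hy
    have h1 : HasFDerivAt (fun x : Plane => (n : ℝ) * (l x - c)) ((n : ℝ) • l) x :=
      (l.hasFDerivAt.sub_const c).const_mul (n : ℝ)
    have h2 : DifferentiableAt ℝ Real.smoothTransition (n * (l x - c)) :=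
      (Real.smoothTransition.contDiff (n := 1)).differentiable one_ne_zero _
    have h3 := (h2.hasDerivAt.comp_hasFDerivAt x h1).fderiv
    change 0 ≤ fderiv ℝ (Real.smoothTransition ∘ fun x => (n : ℝ) * (l x - c)) x y
    rw [h3]
    have h4 : 0 ≤ deriv Real.smoothTransition (n * (l x - c)) :=
      Real.smoothTransition.monotone.deriv_nonneg
    simp only [smul_apply, smul_eq_mul]
    positivity
  have hσlim : ∀ x, Tendsto (fun n => 1 - σ n x) atTop
      (𝓝 ({x | l x ≤ c}.indicator (fun _ => (1 : ℝ)) x)) := by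
    intro x
    by_cases hx : l x ≤ c
    · rw [indicator_of_mem (by exact hx)]
      refine tendsto_const_nhds.congr fun n => ?_
      have : (n : ℝ) * (l x - c) ≤ 0 :=
        mul_nonpos_of_nonneg_of_nonpos n.cast_nonneg (sub_nonpos.2 hx)
      simp [hσ, Real.smoothTransition.zero_of_nonpos this]
    · rw [indicator_of_notMem (by exact hx)]
      refine tendsto_const_nhds.congr' ?_
      filter_upwards [(tendsto_natCast_atTop_atTop.atTop_mul_const
        (sub_pos.2 (not_le.1 hx))).eventually_ge_atTop 1] with n hn
      simp [hσ, Real.smoothTransition.one_of_one_le hn]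
  -- the field `z` on the half-plane, turning into the normal `ν` beyond it
  set y : ℕ → Plane → Plane := fun n x => z x + σ n x • (ν - z x) with hy
  have hνz : ContDiff ℝ ∞ (fun x => ν - z x) := contDiff_const.sub hz.1
  have hys : ∀ n, ContDiff ℝ ∞ (y n) := fun n => hz.1.add ((hσs n).smul hνz)
  have hyn : ∀ n x, ‖y n x‖ ≤ 1 := fun n x => by
    have : y n x = (1 - σ n x) • z x + σ n x • ν := by simp only [hy]; module
    rw [this]
    refine (norm_add_le _ _).trans ?_
    rw [norm_smul, norm_smul, Real.norm_of_nonneg (hσ0 n x),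
      Real.norm_of_nonneg (sub_nonneg.2 (hσ1 n x))]
    nlinarith [hσ0 n x, hσ1 n x, hz.2.2 x, mul_le_of_le_one_right (hσ0 n x) hνn,
      mul_le_of_le_one_right (sub_nonneg.2 (hσ1 n x)) (hz.2.2 x)]
  have hyd : ∀ n x, (1 - σ n x) * divergence z x ≤ divergence (y n) x := fun n x => by
    have e1 : divergence (fun x => ν - z x) x = -divergence z x := by
      rw [divergence_eq_traceForm, divergence_eq_traceForm, fderiv_const_sub, map_neg]
    have e2 : divergence (y n) x = divergence z x + (σ n x * -divergence z x +
        fderiv ℝ (σ n) x (ν - z x)) := by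
      rw [← e1, ← divergence_smul ((hσs n).differentiable (by simp) x)
        (hνz.differentiable (by simp) x)]
      exact divergence_add (hz.1.differentiable (by simp) x)
        (((hσs n).smul hνz).differentiable (by simp) x)
    have := hσd n x _ (hlz x)
    rw [e2]
    linarith
  have hw : ∀ n, IsTestField (fun x => η n x • y n x) := fun n => by
    refine ⟨(hηs n).smul (hys n), (hηc n).smul_right (f' := y n), fun x => ?_⟩
    rw [norm_smul, Real.norm_of_nonneg (hη0 n x)]
    exact mul_le_one₀ (hη1 n x) (norm_nonneg _) (hyn n x)
  set g : ℕ → Plane → ℝ := fun n x =>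
    η n x * (1 - σ n x) * divergence z x - C / ((n : ℝ) + 1) with hg
  have hgle : ∀ n x, g n x ≤ divergence (fun x => η n x • y n x) x := fun n x => by
    rw [divergence_smul ((hηs n).differentiable (by simp) x) ((hys n).differentiable (by simp) x)]
    have h1 := mul_le_mul_of_nonneg_left (hyd n x) (hη0 n x)
    have h2 := neg_le_of_abs_le (hηd n x _ (hyn n x))
    simp only [hg]
    linarith
  have hgc : ∀ n, Continuous (g n) := fun n =>
    (((hηs n).continuous.mul (continuous_const.sub (hσs n).continuous)).mul
      (continuous_divergence hz.1)).sub continuous_const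
  have hgb : ∀ n x, |g n x| ≤ K + C := fun n x => by
    have h1 : |η n x * (1 - σ n x) * divergence z x| ≤ K := by
      rw [abs_mul, abs_of_nonneg (mul_nonneg (hη0 n x) (sub_nonneg.2 (hσ1 n x)))]
      refine (mul_le_of_le_one_left (abs_nonneg _) ?_).trans (hK x)
      exact mul_le_one₀ (hη1 n x) (sub_nonneg.2 (hσ1 n x)) (by linarith [hσ0 n x])
    have h2 : |C / ((n : ℝ) + 1)| ≤ C := by
      rw [abs_of_nonneg (by positivity)]
      exact div_le_self hC0 (by linarith [n.cast_nonneg (α := ℝ)])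
    exact (abs_sub _ _).trans (add_le_add h1 h2)
  have hglim : ∀ x, Tendsto (fun n => u x * g n x) atTop
      (𝓝 ({x | l x ≤ c}.indicator u x * divergence z x)) := by
    intro x
    have h0 : Tendsto (fun n : ℕ => C / ((n : ℝ) + 1)) atTop (𝓝 0) := by
      simpa [div_eq_mul_inv] using
        (tendsto_one_div_add_atTop_nhds_zero_nat (𝕜 := ℝ)).const_mul C
    have := ((((hηlim x).mul (hσlim x)).mul_const (divergence z x)).sub h0).const_mul (u x)
    convert this using 2
    by_cases hx : l x ≤ c <;> simp [indicator, hx]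
  have ht : Tendsto (fun n => ∫ x, u x * g n x) atTop
      (𝓝 (∫ x, {x | l x ≤ c}.indicator u x * divergence z x)) := by
    refine tendsto_integral_of_dominated_convergence (fun x => |u x| * (K + C))
      (fun n => hu.aestronglyMeasurable.mul (hgc n).aestronglyMeasurable)
      (hu.abs.mul_const _) (fun n => ae_of_all _ fun x => ?_) (ae_of_all _ hglim)
    rw [Real.norm_eq_abs, abs_mul]
    exact mul_le_mul_of_nonneg_left (hgb n x) (abs_nonneg _)
  refine le_of_tendsto ((ENNReal.continuous_ofReal.tendsto _).comp ht)
    (Eventually.of_forall fun n => le_trans (ENNReal.ofReal_le_ofReal ?_)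
      ((hw n).le_totalVariation u))
  refine integral_mono (hu.mul_bdd (hgc n).aestronglyMeasurable (ae_of_all _ (hgb n)))
    (integrable_mul_divergence hu (hw n).1 (hw n).2.1) fun x => ?_
  exact mul_le_mul_of_nonneg_left (hgle n x) (hu0 x)

/-- Restricting a nonnegative function to a convex set does not increase its total variation. -/
lemma totalVariation_indicator_convex_le {K : Set Plane} (hK : Convex ℝ K) {u : Plane → ℝ}
    (hu : Integrable u) (hu0 : ∀ x, 0 ≤ u x) :
    totalVariation (K.indicator u) ≤ totalVariation u := by
  obtain ⟨l, c, hlc⟩ := RCLike.iInter_countable_halfSpaces_eq (𝕜 := ℝ) hK.closure isClosed_closure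
  simp only [RCLike.re_to_real] at hlc
  have hae : K.indicator u =ᵐ[volume] (closure K).indicator u :=
    indicator_ae_eq_of_ae_eq_set (closure_ae_eq_of_null_frontier
      (hK.addHaar_frontier volume)).symm
  rw [totalVariation_congr hae]
  set A : ℕ → Set Plane := fun n => {x | ∀ k < n, l k x ≤ c k} with hA
  have hAm : ∀ n, MeasurableSet (A n) := fun n => by
    simp only [hA, ofPred_forall]
    exact MeasurableSet.iInter fun k => MeasurableSet.iInter fun _ =>
      measurableSet_le (l k).continuous.measurable measurable_const
  have hstep : ∀ n, totalVariation ((A n).indicator u) ≤ totalVariation u := by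
    intro n
    induction n with
    | zero => simp [hA]
    | succ n ih =>
      have h1 : (A (n + 1)).indicator u = {x | l n x ≤ c n}.indicator ((A n).indicator u) := by
        rw [indicator_indicator]
        congr 1
        ext x
        simp only [hA, mem_ofPred_eq, mem_inter_iff, Nat.lt_succ_iff_lt_or_eq]
        grind
      rw [h1]
      exact (totalVariation_indicator_halfSpace_le _ _ (hu.indicator (hAm n))
        fun x => indicator_nonneg (fun x _ => hu0 x) x).trans ih
  refine (totalVariation_le_liminf (u := fun n => (A n).indicator u) hu.abs
    (fun n => (hu.indicator (hAm n)).aestronglyMeasurable)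
    (Eventually.of_forall fun n x => ?_) (ae_of_all _ fun x => ?_)).trans
    (liminf_le_of_le (by isBoundedDefault) fun b hb =>
      let ⟨n, hn⟩ := hb.exists; hn.trans (hstep n))
  · exact norm_indicator_le_norm_self u x
  · refine tendsto_const_nhds.congr' ?_
    by_cases hx : x ∈ closure K
    · refine Eventually.of_forall fun n => ?_
      have hxA : x ∈ A n := fun k _ => mem_iInter.1 (hlc ▸ hx) k
      change (closure K).indicator u x = (A n).indicator u x
      rw [indicator_of_mem hx, indicator_of_mem hxA]
    · have hx' := hx
      rw [← hlc, mem_iInter, not_forall] at hx'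
      obtain ⟨k, hk⟩ := hx'
      filter_upwards [eventually_gt_atTop k] with n hn
      have hxA : x ∉ A n := fun h : ∀ k < n, l k x ≤ c k => hk (h k hn)
      change (closure K).indicator u x = (A n).indicator u x
      rw [indicator_of_notMem hx, indicator_of_notMem hxA]

lemma perimeter_inter_convex_le {E K : Set Plane} (hK : Convex ℝ K)
    (hE : Integrable (E.indicator fun _ => (1 : ℝ))) : perimeter (E ∩ K) ≤ perimeter E := by
  have := totalVariation_indicator_convex_le hK hE fun x =>
    indicator_nonneg (fun _ _ => zero_le_one) x
  rwa [indicator_indicator, inter_comm] at this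

/-! ### A lower bound for the perimeter of bounded sets -/

/-- Testing with the field `x / (2R)`, whose divergence is `1 / R`. -/
lemma volume_le_mul_perimeter {E : Set Plane} {R : ℝ} (hR : 0 < R)
    (hER : E ≤ᵐ[volume] Metric.ball (0 : Plane) R) (hE : MeasurableSet E) :
    volume E ≤ ENNReal.ofReal R * perimeter E := by
  let φ : ContDiffBump (0 : Plane) := ⟨R, 2 * R, hR, by linarith⟩
  have hφs : ContDiff ℝ ∞ φ := φ.contDiff
  have hz : IsTestField (fun x => φ x • ((2 * R)⁻¹ • x)) := by
    refine ⟨hφs.smul (by fun_prop), φ.hasCompactSupport.smul_right, fun x => ?_⟩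
    by_cases hx : x ∈ Metric.ball (0 : Plane) (2 * R)
    · rw [norm_smul, norm_smul, Real.norm_of_nonneg φ.nonneg]
      refine mul_le_one₀ φ.le_one (by positivity) ?_
      rw [Real.norm_of_nonneg (by positivity), inv_mul_le_iff₀ (by positivity), mul_one]
      exact (mem_ball_zero_iff.1 hx).le
    · simp [φ.zero_of_le_dist (not_lt.1 hx)]
  have hdiv : ∀ x ∈ Metric.ball (0 : Plane) R,
      divergence (fun x => φ x • ((2 * R)⁻¹ • x)) x = R⁻¹ := by
    intro x hx
    have hev : (fun x => φ x • ((2 * R)⁻¹ • x)) =ᶠ[𝓝 x] fun x => (2 * R)⁻¹ • x := by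
      filter_upwards [Metric.isOpen_ball.mem_nhds hx] with y hy
      rw [φ.one_of_mem_closedBall (Metric.ball_subset_closedBall hy), one_smul]
    have hd : HasFDerivAt (fun x : Plane => (2 * R)⁻¹ • x)
        ((2 * R)⁻¹ • ContinuousLinearMap.id ℝ Plane) x := (hasFDerivAt_id x).fun_const_smul _
    rw [divergence_eq_traceForm, hev.fderiv_eq, hd.fderiv, map_smul]
    have : traceForm (ContinuousLinearMap.id ℝ Plane) = 2 := by
      simp [traceForm, one_add_one_eq_two]
    rw [this, smul_eq_mul]
    field_simp
  have hint : ∫ x, E.indicator (fun _ => (1 : ℝ)) x *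
      divergence (fun x => φ x • ((2 * R)⁻¹ • x)) x = R⁻¹ * volume.real E := by
    have : (fun x => E.indicator (fun _ => (1 : ℝ)) x *
        divergence (fun x => φ x • ((2 * R)⁻¹ • x)) x) =ᵐ[volume] E.indicator fun _ => R⁻¹ := by
      filter_upwards [hER] with x hx
      by_cases hxE : x ∈ E
      · rw [indicator_of_mem hxE, indicator_of_mem hxE, hdiv x (hx hxE), one_mul]
      · rw [indicator_of_notMem hxE, indicator_of_notMem hxE, zero_mul]
    rw [integral_congr_ae this, integral_indicator hE, setIntegral_const, smul_eq_mul, mul_comm]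
  have hfin : volume E ≠ ⊤ := ((measure_mono_ae hER).trans_lt measure_ball_lt_top).ne
  calc volume E = ENNReal.ofReal R * ENNReal.ofReal (R⁻¹ * volume.real E) := by
        rw [← ENNReal.ofReal_mul hR.le, mul_inv_cancel_left₀ hR.ne', ofReal_measureReal hfin]
    _ ≤ ENNReal.ofReal R * perimeter E := by
        rw [← hint]
        gcongr
        exact hz.le_totalVariation _

/-! ### The variational argument -/

lemma integrable_indicator_one {E : Set Plane} (hE : MeasurableSet E) (hf : volume E ≠ ⊤) :
    Integrable (E.indicator fun _ => (1 : ℝ)) :=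
  (integrable_indicator_iff hE).2 (by simpa using hf.lt_top)

lemma HasFinitePerimeter.volume_ne_top {E : Set Plane} (hE : HasFinitePerimeter E) :
    volume E ≠ ⊤ := by
  have := (integrable_indicator_iff hE.1).1 hE.2.1
  exact LT.lt.ne (by simpa using this)

lemma HasFinitePerimeter.cheegerRatio_ne_top {E : Set Plane} (hE : HasFinitePerimeter E)
    (h0 : volume E ≠ 0) : cheegerRatio E ≠ ⊤ :=
  ENNReal.div_ne_top hE.2.2.ne h0

/-- A Cheeger set minimizes `Per - λ |·|`, with minimum `0`, among all subsets of finite measure. -/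
lemma IsCheegerSet.cheegerRatio_mul_volume_le {A E F : Set Plane} (hE : IsCheegerSet A E)
    (hF : MeasurableSet F) (hfin : volume F ≠ ⊤) (hFA : F ≤ᵐ[volume] A) :
    cheegerRatio E * volume F ≤ perimeter F := by
  by_cases hF0 : volume F = 0
  · simp [hF0]
  by_cases hP : perimeter F = ⊤
  · simp [hP]
  exact ENNReal.mul_le_of_le_div
    (hE.2.2.2 F ⟨hF, integrable_indicator_one hF hfin, lt_top_iff_ne_top.2 hP⟩ hF0 hFA)

lemma IsObstacleMinimizer.le_of_measurableSet {lam : ℝ≥0∞} {Ωs A E F : Set Plane}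
    (hE : IsObstacleMinimizer lam Ωs A E) (hF : MeasurableSet F) (hfin : volume F ≠ ⊤)
    (hsF : Ωs ≤ᵐ[volume] F) (hFA : F ≤ᵐ[volume] A) :
    perimeter E + lam * volume E ≤ perimeter F + lam * volume F := by
  by_cases hP : perimeter F = ⊤
  · simp [hP]
  exact hE.2.2.2 F ⟨hF, integrable_indicator_one hF hfin, lt_top_iff_ne_top.2 hP⟩ hsF hFA

/-- A minimal minimizer in the plane that lies in `Ω` is a minimal minimizer in `Ω`. -/
lemma IsMinimalObstacleMinimizer.of_univ {lam : ℝ≥0∞} {Ωs Ω E : Set Plane}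
    (hE : IsMinimalObstacleMinimizer lam Ωs univ E) (hEΩ : E ≤ᵐ[volume] Ω) :
    IsMinimalObstacleMinimizer lam Ωs Ω E := by
  have huniv : ∀ F : Set Plane, F ≤ᵐ[volume] univ := fun F => ae_of_all _ fun _ _ => trivial
  refine ⟨⟨hE.1.1, hE.1.2.1, hEΩ, fun F hF hs _ => hE.1.2.2.2 F hF hs (huniv F)⟩,
    fun F hF hFE => hE.2 F ⟨hF.1, hF.2.1, huniv F, fun G hG hs _ => ?_⟩ hFE⟩
  exact (hF.2.2.2 E hE.1.1 hE.1.2.1 hEΩ).trans (hE.1.2.2.2 G hG hs (huniv G))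

/-- A minimal minimizer in the plane lies in `Ω` if `Ω` is convex, since cutting with `Ω`
increases neither the perimeter nor the area. -/
lemma IsMinimalObstacleMinimizer.le_of_convex {lam : ℝ≥0∞} {Ωs Ω E : Set Plane}
    (hΩ : MeasurableSet Ω) (hconv : Convex ℝ Ω) (hsub : Ωs ⊆ Ω)
    (hE : IsMinimalObstacleMinimizer lam Ωs univ E) : E ≤ᵐ[volume] Ω := by
  have hper := perimeter_inter_convex_le hconv hE.1.1.2.1
  have hmin : IsObstacleMinimizer lam Ωs univ (E ∩ Ω) := by
    refine ⟨⟨hE.1.1.1.inter hΩ, ?_, hper.trans_lt hE.1.1.2.2⟩, ?_,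
      ae_of_all _ fun _ _ => trivial, fun F hF hs hu => ?_⟩
    · exact integrable_indicator_one (hE.1.1.1.inter hΩ)
        (measure_ne_top_of_subset inter_subset_left hE.1.1.volume_ne_top)
    · filter_upwards [hE.1.2.1] with x hx hxs using ⟨hx hxs, hsub hxs⟩
    · refine le_trans ?_ (hE.1.2.2.2 F hF hs hu)
      gcongr
      exact inter_subset_left
  filter_upwards [hE.2 _ hmin (ae_of_all _ fun _ hx => hx.1)] with x hx hxE using (hx hxE).2

/-- The minimal obstacle minimizer does not meet the Cheeger set `C`: removing `C` from it keeps it a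
minimizer. -/
lemma IsMinimalObstacleMinimizer.volume_inter_eq_zero {Ωs Ω E C : Set Plane}
    (hC : IsCheegerSet (Ω \ Ωs) C)
    (hE : IsMinimalObstacleMinimizer (cheegerRatio C) Ωs Ω E) : volume (E ∩ C) = 0 := by
  set lam := cheegerRatio C with hlam
  have hlamt : lam ≠ ⊤ := hC.1.cheegerRatio_ne_top hC.2.1
  have hEf := hE.1.1.volume_ne_top
  have hCf := hC.1.volume_ne_top
  have hEm := hE.1.1.1
  have hCm := hC.1.1
  have hd := perimeter_diff_add_perimeter_diff_le hE.1.1.2.1 hC.1.2.1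
  have hCE := hC.cheegerRatio_mul_volume_le (hCm.diff hEm)
    (measure_ne_top_of_subset sdiff_subset hCf) (by
      filter_upwards [hC.2.2.1] with x hx hxC using hx hxC.1)
  have hperC : perimeter C = lam * volume C := (ENNReal.div_mul_cancel hC.2.1 hCf).symm
  have hvE : volume E = volume (E ∩ C) + volume (E \ C) := (measure_inter_add_sdiff E hCm).symm
  have hvC : volume C = volume (E ∩ C) + volume (C \ E) := by
    rw [inter_comm]; exact (measure_inter_add_sdiff C hEm).symm
  have hsC : Ωs ≤ᵐ[volume] (E \ C : Set Plane) := by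
    filter_upwards [hE.1.2.1, hC.2.2.1] with x h1 h2 hxs using ⟨h1 hxs, fun hxC => (h2 hxC).2 hxs⟩
  have hle : perimeter (E \ C) + lam * volume (E \ C) ≤ perimeter E + lam * volume E := by
    have hfin : lam * volume (C \ E) ≠ ⊤ :=
      ENNReal.mul_ne_top hlamt (measure_ne_top_of_subset sdiff_subset hCf)
    refine (ENNReal.add_le_add_iff_right hfin).1 ?_
    calc perimeter (E \ C) + lam * volume (E \ C) + lam * volume (C \ E)
        = (perimeter (E \ C) + lam * volume (C \ E)) + lam * volume (E \ C) := by ring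
      _ ≤ (perimeter (E \ C) + perimeter (C \ E)) + lam * volume (E \ C) := by gcongr
      _ ≤ (perimeter E + perimeter C) + lam * volume (E \ C) := by gcongr
      _ = perimeter E + lam * volume E + lam * volume (C \ E) := by
        rw [hperC, hvE, hvC]; ring
  have hmin : IsObstacleMinimizer lam Ωs Ω (E \ C) := by
    refine ⟨⟨hEm.diff hCm, integrable_indicator_one (hEm.diff hCm)
      (measure_ne_top_of_subset sdiff_subset hEf), ?_⟩, hsC, ?_,
      fun F hF hs hu => hle.trans (hE.1.2.2.2 F hF hs hu)⟩
    · exact (le_self_add.trans hd).trans_lt (ENNReal.add_lt_top.2 ⟨hE.1.1.2.2, hC.1.2.2⟩)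
    · filter_upwards [hE.1.2.2.1] with x hx hxE using hx hxE.1
  have := hE.2 _ hmin (ae_of_all _ fun _ hx => hx.1)
  refine measure_eq_zero_iff_ae_notMem.2 ?_
  filter_upwards [this] with x hx hxEC using (hx hxEC.1).2 hxEC.2

/-- The positive and negative layers of a function of zero mean have the same total area. -/
lemma lintegral_volume_sublevel_eq {v : Plane → ℝ} (hv : Integrable v) (h0 : ∫ x, v x = 0) :
    ∫⁻ t in Iio 0, volume {x | v x ≤ t} = ∫⁻ t in Ioi 0, volume {x | t < v x} ∧
      ∫⁻ t in Ioi 0, volume {x | t < v x} ≠ ⊤ := by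
  have hp : ∫⁻ t in Ioi 0, volume {x | t < v x} = ∫⁻ x, ENNReal.ofReal (v x) := by
    have := lintegral_eq_lintegral_meas_lt volume (f := fun x => max (v x) 0)
      (ae_of_all _ fun x => le_max_right _ _) hv.pos_part.aemeasurable
    simp only [ENNReal.ofReal_max, ENNReal.ofReal_zero, max_eq_left zero_le] at this
    rw [this]
    refine setLIntegral_congr_fun measurableSet_Ioi fun t ht => ?_
    simp [not_lt.2 (le_of_lt (mem_Ioi.1 ht))]
  have hn : ∫⁻ t in Iio 0, volume {x | v x ≤ t} = ∫⁻ x, ENNReal.ofReal (-v x) := by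
    have := lintegral_eq_lintegral_meas_le volume (f := fun x => max (-v x) 0)
      (ae_of_all _ fun x => le_max_right _ _) hv.neg_part.aemeasurable
    simp only [ENNReal.ofReal_max, ENNReal.ofReal_zero, max_eq_left zero_le] at this
    rw [this, ← (Measure.measurePreserving_neg (volume : Measure ℝ)).setLIntegral_comp_preimage_emb
      (MeasurableEquiv.neg ℝ).measurableEmbedding]
    simp only [neg_preimage, neg_Iio, neg_zero]
    refine setLIntegral_congr_fun measurableSet_Ioi fun t ht => ?_
    simp [not_le.2 (mem_Ioi.1 ht), le_neg]
  have hpf : ∫⁻ x, ENNReal.ofReal (v x) ≠ ⊤ := hv.lintegral_lt_top.ne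
  have hnf : ∫⁻ x, ENNReal.ofReal (-v x) ≠ ⊤ := hv.neg.lintegral_lt_top.ne
  rw [integral_eq_lintegral_pos_part_sub_lintegral_neg_part hv, sub_eq_zero] at h0
  rw [hp, hn]
  exact ⟨((ENNReal.toReal_eq_toReal_iff' hpf hnf).1 h0).symm, hpf⟩

/-- The lower bound for exchange flows: by the coarea inequality, the superlevel sets at the levels
`0 < t < 1`, which contain `Ωs`, contribute at least `m - λ |{v > t}|`, and the sublevel sets at
negative levels contribute at least `λ |{v ≤ t}|`; the area terms balance since the mean vanishes. -/
lemma le_totalVariation_of_mem_exchangeBV {Ω Ωs : Set Plane} {m lam : ℝ≥0∞}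
    (hlam : lam ≠ ⊤) (hm : ∀ F, MeasurableSet F → Ωs ≤ᵐ[volume] F → F ≤ᵐ[volume] Ω →
      m ≤ perimeter F + lam * volume F)
    (hc : ∀ F, MeasurableSet F → F ≤ᵐ[volume] (Ω \ Ωs : Set Plane) →
      lam * volume F ≤ perimeter F)
    {v : Plane → ℝ} (hv : v ∈ exchangeBV Ω Ωs 1) : m ≤ totalVariation v := by
  obtain ⟨⟨hvi, -⟩, hv0, hvs, hvΩ⟩ := hv
  rw [setIntegral_eq_integral_of_ae_compl_eq_zero hvΩ] at hv0
  -- the level sets have to be Borel, so `v` is replaced by a measurable representative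
  obtain ⟨w, hw, hvw⟩ := hvi.aestronglyMeasurable
  have hwm := hw.measurable
  have hwi : Integrable w := hvi.congr hvw
  rw [integral_congr_ae hvw] at hv0
  rw [totalVariation_congr hvw]
  obtain ⟨hAB, hBf⟩ := lintegral_volume_sublevel_eq hwi hv0
  set B := ∫⁻ t in Ioi 0, volume {x | t < w x} with hB
  have hpos : m ≤ (∫⁻ t in Ioi 0, perimeter {x | t < w x}) + lam * B := by
    have hmeas : Measurable fun t : ℝ => lam * volume {x | t < w x} := by
      refine Measurable.const_mul (Antitone.measurable fun s t hst => ?_) _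
      exact measure_mono fun x hx => lt_of_le_of_lt hst hx
    calc m = ∫⁻ _ in Ioo (0 : ℝ) 1, m := by simp
      _ ≤ ∫⁻ t in Ioo (0 : ℝ) 1, (perimeter {x | t < w x} + lam * volume {x | t < w x}) := by
        refine setLIntegral_mono' measurableSet_Ioo fun t ht => hm _
          (measurableSet_lt measurable_const hwm) ?_ ?_
        · filter_upwards [hvw, hvs] with x h1 h2 hx
          change t < w x
          rw [← h1, h2 hx]
          exact ht.2
        · filter_upwards [hvw, hvΩ] with x h1 h2 (hx : t < w x)
          by_contra hxΩ
          rw [← h1, h2 hxΩ] at hx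
          exact lt_asymm hx ht.1
      _ ≤ ∫⁻ t in Ioi (0 : ℝ), (perimeter {x | t < w x} + lam * volume {x | t < w x}) :=
        lintegral_mono_set Ioo_subset_Ioi_self
      _ = (∫⁻ t in Ioi 0, perimeter {x | t < w x}) + lam * B := by
        rw [lintegral_add_right _ hmeas, lintegral_const_mul' _ _ hlam]
  have hneg : lam * B ≤ ∫⁻ t in Iio 0, perimeter {x | w x ≤ t} := by
    rw [← hAB, ← lintegral_const_mul' _ _ hlam]
    refine setLIntegral_mono' measurableSet_Iio fun t ht => hc _
      (measurableSet_le hwm measurable_const) ?_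
    filter_upwards [hvw, hvΩ, hvs] with x h1 h2 h3 (hx : w x ≤ t)
    have ht0 : t < 0 := ht
    rw [← h1] at hx
    refine ⟨?_, fun hxs => ?_⟩
    · by_contra hxΩ
      rw [h2 hxΩ] at hx
      linarith
    · rw [h3 hxs] at hx
      linarith
  refine (ENNReal.add_le_add_iff_right (ENNReal.mul_ne_top hlam hBf)).1 ?_
  calc m + lam * B ≤ ((∫⁻ t in Ioi 0, perimeter {x | t < w x}) + lam * B) +
        ∫⁻ t in Iio 0, perimeter {x | w x ≤ t} := add_le_add hpos hneg
    _ = ((∫⁻ t in Iio 0, perimeter {x | w x ≤ t}) + ∫⁻ t in Ioi 0, perimeter {x | t < w x}) +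
        lam * B := by ring
    _ ≤ totalVariation w + lam * B := by
      gcongr
      exact lintegral_perimeter_levelSet_le hwi

lemma totalVariation_threeValued_le {E C : Set Plane} (hE : HasFinitePerimeter E)
    (hC : HasFinitePerimeter C) (hC0 : volume C ≠ 0) :
    totalVariation (threeValued E C) ≤ perimeter E + cheegerRatio C * volume E := by
  have h1 : threeValued E C = fun x => E.indicator (fun _ => (1 : ℝ)) x +
      -(volume.real E / volume.real C) * C.indicator (fun _ => (1 : ℝ)) x := by
    ext x
    simp only [threeValued]
    ring
  rw [h1]
  refine (totalVariation_add_le hE.2.1 (hC.2.1.const_mul _)).trans_eq ?_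
  have hCpos : 0 < volume.real C := ENNReal.toReal_pos hC0 hC.volume_ne_top
  rw [totalVariation_const_mul, abs_neg, abs_of_nonneg (by positivity),
    ENNReal.ofReal_div_of_pos hCpos, ofReal_measureReal hE.volume_ne_top,
    ofReal_measureReal hC.volume_ne_top]
  simp only [cheegerRatio, perimeter, div_eq_mul_inv]
  ring

lemma threeValued_mem_exchangeBV {Ω Ωs E C : Set Plane} (hE : HasFinitePerimeter E)
    (hC : HasFinitePerimeter C) (hC0 : volume C ≠ 0) (hEΩ : E ≤ᵐ[volume] Ω)
    (hsE : Ωs ≤ᵐ[volume] E) (hCΩ : C ≤ᵐ[volume] (Ω \ Ωs : Set Plane)) :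
    threeValued E C ∈ exchangeBV Ω Ωs 1 := by
  have hCpos : 0 < volume.real C := ENNReal.toReal_pos hC0 hC.volume_ne_top
  have hout : ∀ᵐ x, x ∉ Ω → threeValued E C x = 0 := by
    filter_upwards [hEΩ, hCΩ] with x h1 h2 hx
    have hxE : x ∉ E := fun h => hx (h1 h)
    have hxC : x ∉ C := fun h => hx (h2 h).1
    simp [threeValued, hxE, hxC]
  refine ⟨⟨hE.2.1.sub (hC.2.1.const_mul _), ?_⟩, ?_, ?_, hout⟩
  · refine (totalVariation_threeValued_le hE hC hC0).trans_lt (ENNReal.add_lt_top.2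
      ⟨hE.2.2, ENNReal.mul_lt_top (hC.cheegerRatio_ne_top hC0).lt_top hE.volume_ne_top.lt_top⟩)
  · rw [setIntegral_eq_integral_of_ae_compl_eq_zero hout]
    simp only [threeValued]
    rw [integral_sub hE.2.1 (hC.2.1.const_mul _), integral_const_mul, integral_indicator hE.1,
      integral_indicator hC.1]
    simp [hCpos.ne']
  · filter_upwards [hsE, hCΩ] with x h1 h2 hx
    have hxE : x ∈ E := h1 hx
    have hxC : x ∉ C := fun h => (h2 h).2 hx
    simp [threeValued, hxE, hxC]

lemma const_mul_mem_exchangeBV {Ω Ωs : Set Plane} {c : ℝ} {v : Plane → ℝ}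
    (hv : v ∈ exchangeBV Ω Ωs c) (a : ℝ) : (fun x => a * v x) ∈ exchangeBV Ω Ωs (a * c) := by
  refine ⟨⟨hv.1.1.const_mul a, ?_⟩, ?_, ?_, ?_⟩
  · rw [totalVariation_const_mul]
    exact ENNReal.mul_lt_top ENNReal.ofReal_lt_top hv.1.2
  · rw [integral_const_mul, hv.2.1, mul_zero]
  · filter_upwards [hv.2.2.1] with x hx hxs using by rw [hx hxs]
  · filter_upwards [hv.2.2.2] with x hx hxs using by rw [hx hxs, mul_zero]

/-- A lower bound for the total variation of the exchange flows equal to `1` in `Ωs` bounds all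
yield quotients, by homogeneity. -/
lemma yieldQuotient_le {Ω Ωs : Set Plane} (hΩs : MeasurableSet Ωs) {m : ℝ≥0∞} (hm0 : m ≠ 0)
    (hmt : m ≠ ⊤) (hm : ∀ v ∈ exchangeBV Ω Ωs 1, m ≤ totalVariation v) {y : ℝ}
    (hy : y ∈ yieldQuotients Ω Ωs) : y ≤ volume.real Ωs / m.toReal := by
  obtain ⟨c, v, hv, hTV, rfl⟩ := hy
  have hmpos : 0 < m.toReal := ENNReal.toReal_pos hm0 hmt
  have hTpos : 0 < (totalVariation v).toReal := ENNReal.toReal_pos hTV hv.1.2.ne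
  have hint : ∫ x in Ωs, v x = c * volume.real Ωs := by
    rw [setIntegral_congr_ae hΩs hv.2.2.1, setIntegral_const, smul_eq_mul, mul_comm]
  have hle : |c| * m.toReal ≤ (totalVariation v).toReal := by
    rcases eq_or_ne c 0 with rfl | hc
    · simp
    have hv1 := const_mul_mem_exchangeBV hv c⁻¹
    rw [inv_mul_cancel₀ hc] at hv1
    have h1 := hm _ hv1
    rw [totalVariation_const_mul] at h1
    have h2 := ENNReal.toReal_mono (ENNReal.mul_ne_top ENNReal.ofReal_ne_top hv.1.2.ne) h1
    rw [ENNReal.toReal_mul, ENNReal.toReal_ofReal (abs_nonneg _), abs_inv] at h2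
    rwa [← le_inv_mul_iff₀ (abs_pos.2 hc)]
  rw [hint, div_le_div_iff₀ hTpos hmpos]
  calc c * volume.real Ωs * m.toReal = volume.real Ωs * (c * m.toReal) := by ring
    _ ≤ volume.real Ωs * (totalVariation v).toReal := by
      refine mul_le_mul_of_nonneg_left (le_trans ?_ hle) measureReal_nonneg
      exact mul_le_mul_of_nonneg_right (le_abs_self c) hmpos.le

theorem mainTheorem2 (Ω Ωs Ωc Ω1c : Set Plane)
    (hΩ : MeasurableSet Ω) (hΩb : Bornology.IsBounded Ω)
    (hΩs : MeasurableSet Ωs) (hsub : Ωs ⊆ Ω) (hpos : volume Ωs ≠ 0)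
    (hc : IsMaximalCheegerSet (Ω \ Ωs) Ωc)
    (h1c : IsMinimalObstacleMinimizer (cheegerRatio Ωc) Ωs Ω Ω1c ∨
      (IsMinimalObstacleMinimizer (cheegerRatio Ωc) Ωs univ Ω1c ∧
        (Convex ℝ Ω ∨ Ω1c ≤ᵐ[volume] Ω))) :
    ((Ω1c, Ωc) ∈ admissiblePairs Ω Ωs ∧
      ∀ p ∈ admissiblePairs Ω Ωs, pairEnergy (Ω1c, Ωc) ≤ pairEnergy p) ∧
    (threeValued Ω1c Ωc ∈ exchangeBV Ω Ωs 1 ∧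
      ∀ v ∈ exchangeBV Ω Ωs 1, totalVariation (threeValued Ω1c Ωc) ≤ totalVariation v) ∧
    IsGreatest (yieldQuotients Ω Ωs)
      (volume.real Ωs / (perimeter Ω1c + cheegerRatio Ωc * volume Ω1c).toReal) := by
  have hC := hc.1
  have hE : IsMinimalObstacleMinimizer (cheegerRatio Ωc) Ωs Ω Ω1c := by
    rcases h1c with h | ⟨h, hconv | hle⟩
    · exact h
    · exact h.of_univ (h.le_of_convex hΩ hconv hsub)
    · exact h.of_univ hle
  have hfin : volume Ω ≠ ⊤ := hΩb.measure_lt_top.ne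
  have hfin' : ∀ {F : Set Plane}, F ≤ᵐ[volume] Ω → volume F ≠ ⊤ := fun h =>
    ne_top_of_le_ne_top hfin (measure_mono_ae h)
  have hdiff : ∀ {F : Set Plane}, F ≤ᵐ[volume] (Ω \ Ωs : Set Plane) → F ≤ᵐ[volume] Ω := fun h => by
    filter_upwards [h] with x hx hxF using (hx hxF).1
  have hlam := hC.1.cheegerRatio_ne_top hC.2.1
  have hdisj := hE.volume_inter_eq_zero hC
  have hEnergy : pairEnergy (Ω1c, Ωc) = perimeter Ω1c + cheegerRatio Ωc * volume Ω1c := by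
    simp only [pairEnergy, cheegerRatio, div_eq_mul_inv]
    ring
  have hobst : ∀ F, MeasurableSet F → Ωs ≤ᵐ[volume] F → F ≤ᵐ[volume] Ω →
      perimeter Ω1c + cheegerRatio Ωc * volume Ω1c ≤ perimeter F + cheegerRatio Ωc * volume F :=
    fun F hF hs hFΩ => hE.1.le_of_measurableSet hF (hfin' hFΩ) hs hFΩ
  have hcheeger : ∀ F, MeasurableSet F → F ≤ᵐ[volume] (Ω \ Ωs : Set Plane) →
      cheegerRatio Ωc * volume F ≤ perimeter F :=
    fun F hF hFΩ => hC.cheegerRatio_mul_volume_le hF (hfin' (hdiff hFΩ)) hFΩ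
  set m := perimeter Ω1c + cheegerRatio Ωc * volume Ω1c with hm
  have hmt : m ≠ ⊤ := ENNReal.add_ne_top.2
    ⟨hE.1.1.2.2.ne, ENNReal.mul_ne_top hlam hE.1.1.volume_ne_top⟩
  have hlow : ∀ v ∈ exchangeBV Ω Ωs 1, m ≤ totalVariation v := fun v hv =>
    le_totalVariation_of_mem_exchangeBV hlam hobst hcheeger hv
  have hmem : threeValued Ω1c Ωc ∈ exchangeBV Ω Ωs 1 :=
    threeValued_mem_exchangeBV hE.1.1 hC.1 hC.2.1 hE.1.2.2.1 hE.1.2.1 hC.2.2.1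
  have hTV : totalVariation (threeValued Ω1c Ωc) = m :=
    le_antisymm (totalVariation_threeValued_le hE.1.1 hC.1 hC.2.1) (hlow _ hmem)
  have hm0 : m ≠ 0 := by
    obtain ⟨R, hR, hΩR⟩ := hΩb.subset_ball_lt 0 0
    have hvol := volume_le_mul_perimeter hR (hE.1.2.2.1.trans (ae_of_all _ hΩR)) hE.1.1.1
    intro h
    rw [hm, add_eq_zero] at h
    rw [h.1, mul_zero] at hvol
    exact hpos (le_antisymm ((measure_mono_ae hE.1.2.1).trans hvol) zero_le)
  refine ⟨⟨⟨hE.1.1.1, hC.1.1, hE.1.2.2.1, hdiff hC.2.2.1, hE.1.2.1, hdisj, hC.2.1⟩, ?_⟩,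
    ⟨hmem, fun v hv => hTV.trans_le (hlow v hv)⟩, ⟨1, _, hmem, hTV ▸ hm0, ?_⟩,
    fun y hy => yieldQuotient_le hΩs hm0 hmt hlow hy⟩
  · rintro ⟨E, F⟩ ⟨hEm, hFm, hEΩ, hFΩ, hsE, hEF, hF0⟩
    rw [hEnergy]
    refine (hobst E hEm hsE hEΩ).trans ?_
    have hFs : F ≤ᵐ[volume] (Ω \ Ωs : Set Plane) := by
      filter_upwards [hFΩ, hsE, measure_eq_zero_iff_ae_notMem.1 hEF] with x h1 h2 h3 hxF
      exact ⟨h1 hxF, fun hxs => h3 ⟨h2 hxs, hxF⟩⟩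
    have hratio : cheegerRatio Ωc ≤ perimeter F / volume F :=
      (ENNReal.le_div_iff_mul_le (Or.inl hF0) (Or.inl (hfin' hFΩ))).2 (hcheeger F hFm hFs)
    calc perimeter E + cheegerRatio Ωc * volume E
        ≤ perimeter E + perimeter F / volume F * volume E := by gcongr
      _ = pairEnergy (E, F) := by
        simp only [pairEnergy, div_eq_mul_inv]
        ring
  · rw [hTV, setIntegral_congr_ae hΩs hmem.2.2.1]
    simp
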